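/- \textbf{Setting.} Let $p>2$ be a prime, $R=\mathbb Z_{(p)}$ the localization of $\mathbb Z$ at $p$, $\mathbb F_p=R/pR$, $n\ge 0$, and $\sigma_i=(i-1,i)\in S_n$ for $2\le i\le n$. For a tableau $t$ (a bijective filling of the Young diagram of a partition of $n$ by $1,\dots,n$) let $c_t(k)$ be the content (column minus row) of the node of $t$ containing $k$. For two tableaux write $s\sim_p t$ if $c_s(k)\equiv c_t(k) \pmod p$ for all $k$. This is an equivalence relation on the set $\mathrm{Std}(n)$ of standard tableaux of all shapes of size $n$, and its classes are called tableau classes. $S_n$ acts on tableaux by permuting the entries. Let $L_k=\sum_{j<k}(j,k)$ be the Jucys–Murphy elements, and put $$E_t=\prod_{-n<c<n}\ \prod_{i:\,c_t(i)\ne c}\frac{L_i-c}{c_t(i)-c}\in\mathbb QS_n ,\qquad E_T=\sum_{t\in T}E_t$$ for a tableau class $T$. For a partition $\lambda$ of $n$ let $t^\lambda$ be the tableau with $1,\dots,n$ filled in along the rows, $x_\lambda$ the sum of the elements of its row stabilizer, $d(t)\in S_n$ the permutation with $d(t)t^\lambda=t$, $x_{st}=d(s)x_\lambda d(t)^{-1}$,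 and $(\mathbb QS_n)^{>\lambda}$ the ideal spanned by the $x_{st}$ with $s,t$ standard of a common shape strictly dominating $\lambda$. The Specht module $S(\lambda)$ is the $RS_n$-submodule of $\mathbb QS_n/(\mathbb QS_n)^{>\lambda}$ generated (equivalently, spanned over $R$) by the classes of $x_{s\lambda}:=x_{s\,t^\lambda}$, $s\in\mathrm{Std}(\lambda)$. Let $\xi_{s\lambda}$ be the class of $E_s x_{s\lambda}E_{t^\lambda}$ in $\mathbb QS_n/(\mathbb QS_n)^{>\lambda}$. A bar denotes reduction modulo $p$, that is $\overline{M}=\mathbb F_p\otimes_R M$, and $\bar x = 1\otimes x$ for $x\in M$. Let $T$ be a tableau class and $2\le i\le n$. Let $h_T\in\mathbb F_p$ be the residue of $c_t(i-1)-c_t(i)$, $t\in T$; it does not depend on $t$. The Brundan–Kleshchev intertwiner $\phi_i$ is defined on elements $a\in\overline{S(\lambda)}$ that are reductions of elements of $E_TS(\lambda)$ by $\phi_i a=\sigma_i a+\frac1{L_{i-1}-L_i}a$ if $h_T\neq 0$, where $$\frac1{L_{i-1}-L_i}\,a:=\frac1{h_T}\sum_{k\ge0}(-1)^k\Big(\frac{L_{i-1}-L_i-h_T}{h_T}\Big)^k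 a ,$$ and by $\phi_i a=\sigma_i a+a$ if $h_T=0$. \textbf{Theorem.} Let $\lambda$ be a partition of $n$, $T$ a tableau class and $x\in E_TS(\lambda)$. Then $x\in S(\lambda)$, and $x$ can be written as $x=\sum_{t}a_t\xi_{t\lambda}$ with $a_t\in\mathbb Q$, the sum being over the standard $\lambda$-tableaux $t$ in $T$. For every such expression of $x$ and every $2\le i\le n$, one has $(L_{i-1}-L_i-h_T)^N\,\bar x=0$ in $\overline{S(\lambda)}$ for all sufficiently large $N$ (so that the series above is finite on $\bar x$), the element $y:=\sum_t a_t\,\phi_i^m\xi_{t\lambda}$ lies in $S(\lambda)$, and $$\phi_i\,\bar x=\bar y .$$ Here, for $s\in\mathrm{Std}(\lambda)$, $h=c_s(i-1)-c_s(i)$ and $t=\sigma_i s$, the vector $\phi_i^m\xi_{s\lambda}$ is given by $$\phi_i^{m}\xi_{s\lambda}=\begin{cases} 0 & \text{if } |h|=1,\\ \xi_{t\lambda} & \text{if } h>1 \text{ and } s\nsim_p t,\\ \frac{h^2-1}{h^2}\,\xi_{t\lambda} & \text{if } h<-1 \text{ and } s\nsim_p t,\\ (1-\frac1h)\,\xi_{s\lambda}+\xi_{t\lambda}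 & \text{if } h>1 \text{ and } s\sim_p t,\\ (1-\frac1h)\,\xi_{s\lambda}+\frac{h^2-1}{h^2}\,\xi_{t\lambda} & \text{if } h<-1 \text{ and } s\sim_p t. \end{cases}$$ The first three cases are called regular, the last two singular. -/

import Mathlib

open scoped TensorProduct

noncomputable section

namespace SeminormalForm

/-! ### The rings `R = ℤ_(p)` and `𝔽_p = R / pR` -/

/-- `R`, the localization of `ℤ` at the prime `p`: the rational numbers whose reduced denominator
is not divisible by `p`. -/
def LocRing (p : ℕ) [Fact p.Prime] : Subring ℚ where
  carrier := {q | ¬ p ∣ q.den}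
  one_mem' := by simpa using (Fact.out : p.Prime).ne_one
  zero_mem' := by simpa using (Fact.out : p.Prime).ne_one
  mul_mem' {a b} ha hb h :=
    ((Fact.out : p.Prime).dvd_mul.1 (h.trans (Rat.mul_den_dvd a b))).elim ha hb
  add_mem' {a b} ha hb h :=
    ((Fact.out : p.Prime).dvd_mul.1 (h.trans (Rat.add_den_dvd a b))).elim ha hb
  neg_mem' {a} ha := by simpa using ha

theorem den_ne_zero {p : ℕ} [Fact p.Prime] (q : LocRing p) : ((q : ℚ).den : ZMod p) ≠ 0 :=
  fun h => q.2 ((ZMod.natCast_eq_zero_iff _ _).1 h)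

/-- The reduction map `R → 𝔽_p`, sending `a / b` to `a b⁻¹`. -/
def reduceRing (p : ℕ) [Fact p.Prime] : LocRing p →+* ZMod p where
  toFun q := ((q : ℚ).num : ZMod p) * (((q : ℚ).den : ZMod p))⁻¹
  map_one' := by simp
  map_zero' := by simp
  map_mul' a b := by
    have h := congrArg (Int.cast : ℤ → ZMod p) (Rat.mul_num_den' (a : ℚ) (b : ℚ))
    push_cast at h
    have h1 := den_ne_zero a
    have h2 := den_ne_zero b
    have h3 : (((a : ℚ) * (b : ℚ)).den : ZMod p) ≠ 0 := den_ne_zero (a * b)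
    rw [Subring.coe_mul]
    field_simp
    linear_combination h
  map_add' a b := by
    have h := congrArg (Int.cast : ℤ → ZMod p) (Rat.add_num_den' (a : ℚ) (b : ℚ))
    push_cast at h
    have h1 := den_ne_zero a
    have h2 := den_ne_zero b
    have h3 : (((a : ℚ) + (b : ℚ)).den : ZMod p) ≠ 0 := den_ne_zero (a + b)
    rw [Subring.coe_add]
    field_simp
    linear_combination h

instance reduceAlgebra (p : ℕ) [Fact p.Prime] : Algebra (LocRing p) (ZMod p) :=
  (reduceRing p).toAlgebra

/-! ### Partitions and tableaux

The letters `1, …, n` are represented by the elements of `Fin n`; nodes are pairs (row, column),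
both counted from `0`. -/

/-- Partitions of `n`, given by their Young diagrams. -/
abbrev Par (n : ℕ) : Type := {μ : YoungDiagram // μ.card = n}

/-- A `μ`-tableau, as the bijection sending each letter to the node it occupies. -/
abbrev Tableau {n : ℕ} (μ : Par n) : Type := Fin n ≃ {c : ℕ × ℕ // c ∈ μ.1.cells}

/-- Entries increase along rows and down columns. -/
def Tableau.IsStandard {n : ℕ} {μ : Par n} (t : Tableau μ) : Prop :=
  ∀ u v : {c : ℕ × ℕ // c ∈ μ.1.cells},
    (u.1.1 = v.1.1 → u.1.2 < v.1.2 → t.symm u < t.symm v) ∧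
    (u.1.2 = v.1.2 → u.1.1 < v.1.1 → t.symm u < t.symm v)

/-- `Std(μ)`. -/
abbrev StdTableau {n : ℕ} (μ : Par n) : Type := {t : Tableau μ // t.IsStandard}

/-- `Std(n)`, the standard tableaux of all shapes of size `n`. -/
abbrev Std (n : ℕ) : Type := Σ μ : Par n, StdTableau μ

theorem cells_subset {n : ℕ} (μ : Par n) :
    μ.1.cells ⊆ Finset.range n ×ˢ Finset.range n := by
  rintro ⟨i, j⟩ h
  have h : (i, j) ∈ μ.1 := (YoungDiagram.mem_cells _).1 h
  have h1 : j < μ.1.rowLen i := YoungDiagram.mem_iff_lt_rowLen.1 h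
  have h2 : i < μ.1.colLen j := YoungDiagram.mem_iff_lt_colLen.1 h
  have h3 : μ.1.rowLen i ≤ n := by
    rw [YoungDiagram.rowLen_eq_card]
    exact (Finset.card_le_card (Finset.filter_subset _ _)).trans μ.2.le
  have h4 : μ.1.colLen j ≤ n := by
    rw [YoungDiagram.colLen_eq_card]
    exact (Finset.card_le_card (Finset.filter_subset _ _)).trans μ.2.le
  simp only [Finset.mem_product, Finset.mem_range]
  omega

instance finitePar (n : ℕ) : Finite (Par n) :=
  Finite.of_injective
    (fun μ : Par n => (⟨μ.1.cells, Finset.mem_powerset.2 (cells_subset μ)⟩ :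
      {s // s ∈ (Finset.range n ×ˢ Finset.range n).powerset}))
    (fun _ _ h => Subtype.ext (YoungDiagram.ext (congrArg Subtype.val h)))

instance fintypeStdTableau {n : ℕ} (μ : Par n) : Fintype (StdTableau μ) := Fintype.ofFinite _

instance fintypeStd (n : ℕ) : Fintype (Std n) := Fintype.ofFinite _

/-- The content `c_t(k)`: column minus row of the node occupied by `k`. -/
def content {n : ℕ} {μ : Par n} (t : Tableau μ) (k : Fin n) : ℤ :=
  ((t k).1.2 : ℤ) - ((t k).1.1 : ℤ)

/-- The `p`-residue `r_t(k)`. -/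
def residue (p : ℕ) {n : ℕ} {μ : Par n} (t : Tableau μ) (k : Fin n) : ZMod p :=
  (content t k : ZMod p)

/-- The relation `s ∼_p t`: equality of the residue sequences. -/
def SameResidues (p : ℕ) {n : ℕ} {μ ν : Par n} (s : Tableau μ) (t : Tableau ν) : Prop :=
  ∀ k, residue p s k = residue p t k

/-- `∼_p` as an equivalence relation on `Std(n)`. -/
def residueSetoid (p n : ℕ) : Setoid (Std n) where
  r s t := SameResidues p s.2.1 t.2.1
  iseqv := ⟨fun _ _ => rfl, fun h k => (h k).symm, fun h h' k => (h k).trans (h' k)⟩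

/-- Tableau classes: the classes of `∼_p` on `Std(n)`. -/
abbrev TableauClass (p n : ℕ) : Type := Quotient (residueSetoid p n)

/-- The class `[t]`. -/
def tableauClass (p : ℕ) {n : ℕ} {μ : Par n} (t : StdTableau μ) : TableauClass p n :=
  Quotient.mk (residueSetoid p n) ⟨μ, t⟩

/-- The residue sequence of a tableau class. -/
def classResidue {p n : ℕ} (T : TableauClass p n) (k : Fin n) : ZMod p :=
  Quotient.lift (s := residueSetoid p n) (fun t : Std n => residue p t.2.1 k)
    (fun s t (h : SameResidues p s.2.1 t.2.1) => h k) T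

/-- The left action of the symmetric group on tableaux: `(σ t)[i,j] = σ (t[i,j])`. -/
def permTableau {n : ℕ} {μ : Par n} (σ : Equiv.Perm (Fin n)) (t : Tableau μ) : Tableau μ :=
  σ.symm.trans t

/-- Strict dominance `ν ▷ μ`. -/
def StrictlyDominates {n : ℕ} (ν μ : Par n) : Prop :=
  ν ≠ μ ∧ ∀ m : ℕ, ∑ i ∈ Finset.range m, μ.1.rowLen i ≤ ∑ i ∈ Finset.range m, ν.1.rowLen i

/-- The cells of `μ` in the lexicographic order, that is, in the reading order along rows. -/
def lexCells {n : ℕ} (μ : Par n) : Finset (ℕ ×ₗ ℕ) := μ.1.cells.map toLex.toEmbedding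

theorem lexCells_card {n : ℕ} (μ : Par n) : (lexCells μ).card = n := by
  rw [lexCells, Finset.card_map]; exact μ.2

/-- The tableau `t^μ` with the letters in order along the rows. -/
def rowTableau {n : ℕ} (μ : Par n) : Tableau μ :=
  ((lexCells μ).orderIsoOfFin (lexCells_card μ)).toEquiv.trans
    (ofLex.subtypeEquiv (by
      intro a
      simp only [lexCells, Finset.mem_map, Equiv.coe_toEmbedding]
      constructor
      · rintro ⟨b, hb, rfl⟩; simpa using hb
      · intro h; exact ⟨_, h, rfl⟩))

/-- The permutation `d(t)` with `d(t) t^μ = t`. -/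
def dPerm {n : ℕ} {μ : Par n} (t : Tableau μ) : Equiv.Perm (Fin n) :=
  (rowTableau μ).trans t.symm

theorem permTableau_dPerm {n : ℕ} {μ : Par n} (t : Tableau μ) :
    permTableau (dPerm t) (rowTableau μ) = t := by
  ext k <;> simp [permTableau, dPerm]

/-! ### The group algebra -/

/-- The group algebra `K S_n`. -/
abbrev GrpAlg (K : Type) [CommRing K] (n : ℕ) : Type := MonoidAlgebra K (Equiv.Perm (Fin n))

/-- A permutation as an element of the group algebra. -/
def permElt (K : Type) [CommRing K] {n : ℕ} (σ : Equiv.Perm (Fin n)) : GrpAlg K n :=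
  MonoidAlgebra.of K (Equiv.Perm (Fin n)) σ

theorem permElt_one (K : Type) [CommRing K] {n : ℕ} :
    permElt K (1 : Equiv.Perm (Fin n)) = 1 :=
  map_one (MonoidAlgebra.of K (Equiv.Perm (Fin n)))

theorem permElt_mul (K : Type) [CommRing K] {n : ℕ} (σ τ : Equiv.Perm (Fin n)) :
    permElt K (σ * τ) = permElt K σ * permElt K τ :=
  map_mul (MonoidAlgebra.of K (Equiv.Perm (Fin n))) σ τ

/-- The Jucys–Murphy element `L_k`, the sum of the transpositions `(j, k)` with `j < k`. -/
def jucysMurphy (K : Type) [CommRing K] {n : ℕ} (k : Fin n) : GrpAlg K n :=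
  ∑ j ∈ Finset.univ.filter (fun j => j < k), permElt K (Equiv.swap j k)

/-- The Jucys–Murphy idempotent `E_t`: the product over `-n < c < n` and over the `i` with
`c_t(i) ≠ c` of `(L_i - c) / (c_t(i) - c)`. The factors commute; a fixed order is used. -/
def jmIdempotent {n : ℕ} {μ : Par n} (t : Tableau μ) : GrpAlg ℚ n :=
  (((List.range (2 * n - 1)).map fun m : ℕ =>
    let c : ℤ := (m : ℤ) - ((n : ℤ) - 1)
    ((List.finRange n).map fun i : Fin n =>
      if content t i = c then (1 : GrpAlg ℚ n)
      else ((1 : ℚ) / ((content t i : ℚ) - (c : ℚ))) •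
        (jucysMurphy ℚ i - algebraMap ℚ (GrpAlg ℚ n) (c : ℚ))).prod)).prod

open scoped Classical in
/-- The tableau class idempotent `E_T = ∑_{t ∈ T} E_t`. -/
def classIdempotent {p n : ℕ} (T : TableauClass p n) : GrpAlg ℚ n :=
  ∑ t : Std n, if tableauClass p t.2 = T then jmIdempotent t.2.1 else 0

open scoped Classical in
/-- `x_μ`, the sum of the elements of the row stabilizer of `t^μ`. -/
def rowSum {n : ℕ} (μ : Par n) : GrpAlg ℚ n :=
  ∑ σ ∈ Finset.univ.filter (fun σ : Equiv.Perm (Fin n) =>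
    ∀ k, (rowTableau μ (σ k)).1.1 = (rowTableau μ k).1.1), permElt ℚ σ

/-- Murphy's element `x_{st} = d(s) x_μ d(t)⁻¹`. -/
def murphyElt {n : ℕ} {μ : Par n} (s t : Tableau μ) : GrpAlg ℚ n :=
  permElt ℚ (dPerm s) * rowSum μ * permElt ℚ (dPerm t)⁻¹

/-- The ideal `(ℚ S_n)^{> μ}` generated by the `x_{st}` with `s`, `t` standard of a common shape
strictly dominating `μ`. (The linear span of these elements is already an ideal.) -/
def higherIdeal {n : ℕ} (μ : Par n) : Submodule (GrpAlg ℚ n) (GrpAlg ℚ n) :=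
  (TwoSidedIdeal.span {a | ∃ ν : Par n, StrictlyDominates ν μ ∧
    ∃ s t : StdTableau ν, a = murphyElt s.1 t.1}).asIdeal

/-- The left module `ℚ S_n / (ℚ S_n)^{> μ}`, in which the Specht module lives. -/
def HigherQuot {n : ℕ} (μ : Par n) : Type := GrpAlg ℚ n ⧸ higherIdeal μ

instance quotAddCommGroup {n : ℕ} (μ : Par n) : AddCommGroup (HigherQuot μ) :=
  inferInstanceAs (AddCommGroup (GrpAlg ℚ n ⧸ higherIdeal μ))

instance quotModule {n : ℕ} (μ : Par n) : Module (GrpAlg ℚ n) (HigherQuot μ) :=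
  inferInstanceAs (Module (GrpAlg ℚ n) (GrpAlg ℚ n ⧸ higherIdeal μ))

instance quotModuleRat {n : ℕ} (μ : Par n) : Module ℚ (HigherQuot μ) :=
  Module.compHom _ (algebraMap ℚ (GrpAlg ℚ n))

instance quotScalarTower {n : ℕ} (μ : Par n) :
    IsScalarTower ℚ (GrpAlg ℚ n) (HigherQuot μ) :=
  ⟨fun r a v => by
    change (r • a) • v = algebraMap ℚ (GrpAlg ℚ n) r • a • v
    rw [Algebra.smul_def, mul_smul]⟩

/-- The class of an element of `ℚ S_n` modulo `(ℚ S_n)^{> μ}`. -/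
def toQuot {n : ℕ} (μ : Par n) (a : GrpAlg ℚ n) : HigherQuot μ := Submodule.Quotient.mk a

theorem smul_toQuot {n : ℕ} (μ : Par n) (a b : GrpAlg ℚ n) :
    a • toQuot μ b = toQuot μ (a * b) :=
  (Submodule.Quotient.mk_smul (higherIdeal μ) a b).symm

/-- The seminormal basis vector `ξ_{sμ} = E_s x_{sμ} E_μ`, as an element of `S(μ)_ℚ`, that is,
modulo `(ℚ S_n)^{> μ}`. -/
def seminormal {n : ℕ} {μ : Par n} (s : Tableau μ) : HigherQuot μ :=
  toQuot μ (jmIdempotent s * murphyElt s (rowTableau μ) * jmIdempotent (rowTableau μ))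

/-! ### The Specht module over `R`, and its reduction modulo `p` -/

/-- The Specht module `S(μ)` over `R`: the `R S_n`-module generated by the classes
`x_{sμ} + (ℚ S_n)^{> μ}`, `s ∈ Std(μ)`. (It is also the `R`-span of these classes.) -/
def specht (p : ℕ) [Fact p.Prime] {n : ℕ} (μ : Par n) : Submodule (LocRing p) (HigherQuot μ) :=
  Submodule.span (LocRing p) {v | ∃ (σ : Equiv.Perm (Fin n)) (s : StdTableau μ),
    v = toQuot μ (permElt ℚ σ * murphyElt s.1 (rowTableau μ))}

/-- Left multiplication by an element of `ℚ S_n`. -/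
def leftMul (p : ℕ) [Fact p.Prime] {n : ℕ} (μ : Par n) (a : GrpAlg ℚ n) :
    HigherQuot μ →ₗ[LocRing p] HigherQuot μ where
  toFun v := a • v
  map_add' := smul_add a
  map_smul' r v := by
    change a • algebraMap ℚ (GrpAlg ℚ n) r • v = algebraMap ℚ (GrpAlg ℚ n) r • a • v
    rw [← mul_smul, ← mul_smul, Algebra.commutes]

theorem leftMul_toQuot (p : ℕ) [Fact p.Prime] {n : ℕ} (μ : Par n) (a b : GrpAlg ℚ n) :
    leftMul p μ a (toQuot μ b) = toQuot μ (a * b) :=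
  smul_toQuot μ a b

theorem leftMul_generator_mem (p : ℕ) [Fact p.Prime] {n : ℕ} (μ : Par n)
    (σ τ : Equiv.Perm (Fin n)) (m : GrpAlg ℚ n)
    (hm : ∃ s : StdTableau μ, m = murphyElt s.1 (rowTableau μ)) :
    leftMul p μ (permElt ℚ σ) (toQuot μ (permElt ℚ τ * m)) ∈ specht p μ := by
  have h : leftMul p μ (permElt ℚ σ) (toQuot μ (permElt ℚ τ * m)) =
      toQuot μ (permElt ℚ (σ * τ) * m) := by
    rw [leftMul_toQuot, permElt_mul, mul_assoc]
  rw [h]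
  obtain ⟨s, hs⟩ := hm
  exact Submodule.subset_span ⟨σ * τ, s, congrArg (fun m => toQuot μ (permElt ℚ (σ * τ) * m)) hs⟩

theorem leftMul_mem (p : ℕ) [Fact p.Prime] {n : ℕ} (μ : Par n) (σ : Equiv.Perm (Fin n))
    (v : HigherQuot μ) (hv : v ∈ specht p μ) : leftMul p μ (permElt ℚ σ) v ∈ specht p μ := by
  have h : specht p μ ≤ (specht p μ).comap (leftMul p μ (permElt ℚ σ)) := by
    refine Submodule.span_le.2 fun w hw => ?_
    rw [SetLike.mem_coe, Submodule.mem_comap]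
    obtain ⟨τ, s, hw⟩ := hw
    rw [hw]
    exact leftMul_generator_mem p μ σ τ _ ⟨s, rfl⟩
  exact Submodule.mem_comap.1 (h hv)

/-- `S(μ)` as a representation of `S_n` over `R`. -/
def spechtRep (p : ℕ) [Fact p.Prime] {n : ℕ} (μ : Par n) :
    Representation (LocRing p) (Equiv.Perm (Fin n)) (specht p μ) where
  toFun σ := (leftMul p μ (permElt ℚ σ)).restrict (leftMul_mem p μ σ)
  map_one' := by
    ext v
    change (permElt ℚ (1 : Equiv.Perm (Fin n))) • v.1 = v.1
    rw [permElt_one, one_smul]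
  map_mul' σ τ := by
    ext v
    change (permElt ℚ (σ * τ)) • v.1 = permElt ℚ σ • permElt ℚ τ • v.1
    rw [permElt_mul, mul_smul]

/-- `E_T S(μ)`, the image of `S(μ)` under `E_T`. -/
def classPart {p : ℕ} [Fact p.Prime] {n : ℕ} (T : TableauClass p n) (μ : Par n) :
    Submodule (LocRing p) (HigherQuot μ) :=
  (specht p μ).map (leftMul p μ (classIdempotent T))

/-- The reduction modulo `p` of `S(μ)`. -/
abbrev SpechtBar (p : ℕ) [Fact p.Prime] {n : ℕ} (μ : Par n) : Type :=
  ZMod p ⊗[LocRing p] (specht p μ)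

/-- The reduction modulo `p` of an element of `S(μ)`. -/
def reduction {p : ℕ} [Fact p.Prime] {n : ℕ} {μ : Par n} (v : specht p μ) : SpechtBar p μ :=
  (1 : ZMod p) ⊗ₜ[LocRing p] v

/-- The action of an element of `R S_n` on the reduction modulo `p` of `S(μ)`. -/
def actBar (p : ℕ) [Fact p.Prime] {n : ℕ} (μ : Par n) (a : GrpAlg (LocRing p) n) :
    Module.End (ZMod p) (SpechtBar p μ) :=
  ((spechtRep p μ).asAlgebraHom a).baseChange (ZMod p)

/-! ### The Brundan–Kleshchev intertwiners

In the following `j` and `k` are the letters `i - 1` and `i`. -/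

/-- The image in `𝔽_p` of `h_T(i) = c_t(i-1) - c_t(i)`, `t ∈ T`. -/
def classH {p n : ℕ} (T : TableauClass p n) (j k : Fin n) : ZMod p :=
  classResidue T j - classResidue T k

/-- The operator `L_{i-1} - L_i - h_T(i)` on the reduction modulo `p` of `S(μ)`. -/
def jmDiffNil {p : ℕ} [Fact p.Prime] {n : ℕ} (T : TableauClass p n) (μ : Par n) (j k : Fin n) :
    Module.End (ZMod p) (SpechtBar p μ) :=
  actBar p μ (jucysMurphy (LocRing p) j - jucysMurphy (LocRing p) k) -
    algebraMap (ZMod p) _ (classH T j k)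

/-- `1 / (L_{i-1} - L_i)` on the reduction of `E_T S(μ)`, as the geometric series
`h⁻¹ ∑_m (-1)^m ((L_{i-1} - L_i - h) / h)^m` with `h = h_T(i) ≠ 0`. On each element of the
reduction of `E_T S(μ)` the sum is finite. -/
def jmDiffInv {p : ℕ} [Fact p.Prime] {n : ℕ} (T : TableauClass p n) (μ : Par n) (j k : Fin n)
    (v : SpechtBar p μ) : SpechtBar p μ :=
  (classH T j k)⁻¹ • ∑ᶠ m : ℕ,
    (-1 : ZMod p) ^ m • (((classH T j k)⁻¹ • jmDiffNil T μ j k) ^ m) v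

open scoped Classical in
/-- The intertwiner `φ_i` on the reduction of `E_T S(μ)`: it is `σ_i + 1 / (L_{i-1} - L_i)` if
`i - 1` and `i` have different residues in `T`, and `σ_i + 1` if they have the same residue. -/
def intertwiner {p : ℕ} [Fact p.Prime] {n : ℕ} (T : TableauClass p n) (μ : Par n) (j k : Fin n)
    (v : SpechtBar p μ) : SpechtBar p μ :=
  actBar p μ (permElt (LocRing p) (Equiv.swap j k)) v +
    if classH T j k = 0 then v else jmDiffInv T μ j k v

open scoped Classical in
/-- The vector `φ_i^m ξ_{sμ}`. The last alternative does not occur for standard `s`, for which the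
radial distance `h = c_s(i-1) - c_s(i)` is never zero. -/
def phiM (p : ℕ) {n : ℕ} {μ : Par n} (j k : Fin n) (s : Tableau μ) : HigherQuot μ :=
  let h : ℤ := content s j - content s k
  let t : Tableau μ := permTableau (Equiv.swap j k) s
  if |h| = 1 then 0
  else if 1 < h ∧ ¬ SameResidues p s t then seminormal t
  else if h < -1 ∧ ¬ SameResidues p s t then (((h : ℚ) ^ 2 - 1) / (h : ℚ) ^ 2) • seminormal t
  else if 1 < h ∧ SameResidues p s t then (1 - 1 / (h : ℚ)) • seminormal s + seminormal t
  else if h < -1 ∧ SameResidues p s t then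
    (1 - 1 / (h : ℚ)) • seminormal s + (((h : ℚ) ^ 2 - 1) / (h : ℚ) ^ 2) • seminormal t
  else 0

open scoped Classical in
/-- The sum `∑_{t ∈ T} a_t v_t` over the standard `μ`-tableaux `t` in the class `T`. -/
def classSum {p n : ℕ} (T : TableauClass p n) {μ : Par n} (a : StdTableau μ → ℚ)
    (v : Tableau μ → HigherQuot μ) : HigherQuot μ :=
  ∑ t : StdTableau μ, if tableauClass p t = T then a t • v t.1 else 0

end SeminormalForm

end

open scoped TensorProduct

noncomputable section

namespace SeminormalForm

/-! ### Relations in the group algebra -/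

/-! Over `ℚ` the Specht module is spanned by the vectors `ξ_t`, on which each `L_k` acts by the
content `c_t(k)`, and `σ_i + 1/h` with `h = c_s(i-1) - c_s(i)` carries the weight of `s` to that of
`σ_i s`. All five cases of `φ_i^m ξ_s` are therefore the single formula `σ_i ξ_s + r ξ_s`, with `r =
1` if `p ∣ h` and `r = 1/h` otherwise (`phiM_eq`).

If `h_T = 0`, the theorem is then immediate by linearity. If `h_T ≠ 0`, choose an integer lift `H`
of `h_T`. On `ξ_t` with `t ∈ T` the operator `L_{i-1} - L_i - H` is an integer multiple of `p`, so a
truncated geometric series differs from `1/h` by a remainder divisible by a high power of `p`. Each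
`ξ_t` has a `p`-power multiple in the lattice `S(μ)`; hence for a late truncation the total
remainder lies in `p S(μ)` and disappears in the reduction (`intertwiner_reduction`). The same
mechanism shows that `E_T` preserves `S(μ)`: by Fermat's little theorem a polynomial in the `L_k`
with integer coefficients acts on `ξ_t` by an integer congruent to 1 or 0 modulo `p` according to
whether `t ∈ T`, and its `p^M`-th power agrees with `E_T` modulo `p^M` (`classIdempotent_smul_mem`).

The seminormal form rests on three facts. The class of `x_μ` is a weight vector, because moving a
letter to a higher row leads into the higher ideal (`youngSum_update_mem`). When two neighbouring
weights differ by one, a positive definite invariant form forces the transposition to act by a sign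
(`swap_smul_of_abs_eq_one`), so only weights of standard tableaux arise. Finally, `d(t) x_μ`
involves only weights of tableaux dominating `t` (`dPerm_smul_mem_domSpan`), which gives the
transition from `ξ_s` to `ξ_{σ_i s}`. Linear independence of the `ξ_t` is not needed: the argument
applies to any expression of `x`. -/

theorem permElt_mul_swap (K : Type) [CommRing K] {n : ℕ} (g : Equiv.Perm (Fin n)) (a b : Fin n) :
    permElt K g * permElt K (Equiv.swap a b) =
      permElt K (Equiv.swap (g a) (g b)) * permElt K g := by
  rw [← permElt_mul, ← permElt_mul, Equiv.swap_apply_apply, inv_mul_cancel_right]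

theorem permElt_swap_mul_self (K : Type) [CommRing K] {n : ℕ} (a b : Fin n) :
    permElt K (Equiv.swap a b) * permElt K (Equiv.swap a b) = 1 := by
  rw [← permElt_mul, Equiv.swap_mul_self, permElt_one]

/-- Conjugation by `g` merely permutes the summands `(i, m)`, since `g` fixes `m` and permutes the
letters before it. -/
theorem permElt_mul_jucysMurphy (K : Type) [CommRing K] {n : ℕ} (g : Equiv.Perm (Fin n))
    (m : Fin n) (hm : g m = m) (hg : ∀ i, g i < m ↔ i < m) :
    permElt K g * jucysMurphy K m = jucysMurphy K m * permElt K g := by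
  rw [jucysMurphy, Finset.mul_sum, Finset.sum_mul]
  refine Finset.sum_equiv g (fun i => by simp [hg]) fun i _ => ?_
  rw [permElt_mul_swap, hm]

theorem swap_lt_iff {n : ℕ} {j k : Fin n} (hjk : (j : ℕ) + 1 = k) {m : Fin n} (hmk : m ≠ k)
    (i : Fin n) : Equiv.swap j k i < m ↔ i < m := by
  rcases eq_or_ne i j with rfl | h1
  · rw [Equiv.swap_apply_left]; omega
  rcases eq_or_ne i k with rfl | h2
  · rw [Equiv.swap_apply_right]; omega
  rw [Equiv.swap_apply_of_ne_of_ne h1 h2]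

theorem swap_mul_jucysMurphy_of_ne (K : Type) [CommRing K] {n : ℕ} {j k : Fin n}
    (hjk : (j : ℕ) + 1 = k) {m : Fin n} (hmj : m ≠ j) (hmk : m ≠ k) :
    permElt K (Equiv.swap j k) * jucysMurphy K m =
      jucysMurphy K m * permElt K (Equiv.swap j k) :=
  permElt_mul_jucysMurphy K _ m (Equiv.swap_apply_of_ne_of_ne hmj hmk) (swap_lt_iff hjk hmk)

/-- Conjugation by `(j, k)` turns the summands `(i, j)` of `L_j` into the summands `(i, k)` of `L_k`
with `i < j`. The one remaining summand `(j, k)` of `L_k` squares to 1. -/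
theorem jucysMurphy_mul_swap (K : Type) [CommRing K] {n : ℕ} {j k : Fin n}
    (hjk : (j : ℕ) + 1 = k) :
    jucysMurphy K k * permElt K (Equiv.swap j k) =
      permElt K (Equiv.swap j k) * jucysMurphy K j + 1 := by
  have hs : Finset.univ.filter (fun i : Fin n => i < k) =
      insert j (Finset.univ.filter fun i : Fin n => i < j) := by
    ext i
    simp only [Finset.mem_filter, Finset.mem_univ, true_and, Finset.mem_insert]
    omega
  rw [jucysMurphy, hs, Finset.sum_insert (by simp), add_mul, permElt_swap_mul_self, add_comm,
    jucysMurphy, Finset.mul_sum, Finset.sum_mul]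
  congr 1
  refine Finset.sum_congr rfl fun i hi => ?_
  have hi : i < j := by simpa using hi
  rw [permElt_mul_swap K (Equiv.swap j k) i j, Equiv.swap_apply_left,
    Equiv.swap_apply_of_ne_of_ne (by omega) (by omega)]

theorem jucysMurphy_mul_swap' (K : Type) [CommRing K] {n : ℕ} {j k : Fin n}
    (hjk : (j : ℕ) + 1 = k) :
    jucysMurphy K j * permElt K (Equiv.swap j k) =
      permElt K (Equiv.swap j k) * jucysMurphy K k - 1 := by
  have h := jucysMurphy_mul_swap K hjk
  have h2 := permElt_swap_mul_self K j k
  calc jucysMurphy K j * permElt K (Equiv.swap j k)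
      = permElt K (Equiv.swap j k) * (permElt K (Equiv.swap j k) * jucysMurphy K j + 1)
          * permElt K (Equiv.swap j k) - permElt K (Equiv.swap j k) * permElt K (Equiv.swap j k) := by
        rw [mul_add, ← mul_assoc, h2, one_mul, mul_one, add_mul, h2, add_sub_cancel_right]
    _ = _ := by rw [← h, h2, mul_assoc, mul_assoc, h2, mul_one]

/-- The adjacent transpositions generate the symmetric group. -/
theorem permElt_induction {n : ℕ} {P : Equiv.Perm (Fin n) → Prop} (h1 : P 1)
    (h : ∀ (j k : Fin n), (j : ℕ) + 1 = k → ∀ g, P g → P (Equiv.swap j k * g)) :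
    ∀ g, P g := by
  intro g
  cases n with
  | zero => rwa [Subsingleton.elim g 1]
  | succ n =>
    have hg : g ∈ Submonoid.closure
        (Set.range fun i : Fin n => Equiv.swap i.castSucc i.succ) := by
      rw [Equiv.Perm.mclosure_swap_castSucc_succ]; trivial
    induction hg using Submonoid.closure_induction_left with
    | one => exact h1
    | mul_left x hx y _ hy =>
      obtain ⟨i, rfl⟩ := hx
      exact h _ _ (by simp) _ hy

/-! ### Weight spaces of the Jucys–Murphy elements -/

set_option linter.unusedSectionVars false

section Weight

variable {n : ℕ} {V : Type} [AddCommGroup V] [Module ℚ V] [Module (GrpAlg ℚ n) V]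
  [IsScalarTower ℚ (GrpAlg ℚ n) V]

theorem grpAlg_smul_comm (r : ℚ) (a : GrpAlg ℚ n) (v : V) : a • r • v = r • a • v := by
  rw [← algebraMap_smul (GrpAlg ℚ n) r v, ← algebraMap_smul (GrpAlg ℚ n) r (a • v), ← mul_smul,
    ← mul_smul, Algebra.commutes]

/-- Left multiplication by an element of the group algebra, as a rational linear map. -/
def actLin (V : Type) [AddCommGroup V] [Module ℚ V] [Module (GrpAlg ℚ n) V]
    [IsScalarTower ℚ (GrpAlg ℚ n) V] (a : GrpAlg ℚ n) : V →ₗ[ℚ] V where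
  toFun v := a • v
  map_add' := smul_add a
  map_smul' r v := grpAlg_smul_comm r a v

@[simp] theorem actLin_apply (a : GrpAlg ℚ n) (v : V) : actLin V a v = a • v := rfl

/-- The vectors on which each `L_k` acts by the scalar `a k`. -/
def wt (V : Type) [AddCommGroup V] [Module ℚ V] [Module (GrpAlg ℚ n) V]
    [IsScalarTower ℚ (GrpAlg ℚ n) V] (a : Fin n → ℤ) : Submodule ℚ V where
  carrier := {v | ∀ k, jucysMurphy ℚ k • v = (a k : ℚ) • v}
  add_mem' hv hw k := by rw [smul_add, hv k, hw k, smul_add]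
  zero_mem' k := by simp
  smul_mem' r v hv k := by rw [grpAlg_smul_comm, hv k, smul_comm]

/-- The intertwining element maps a weight space to the one with permuted weight. -/
theorem intertwine_mem_wt {a : Fin n → ℤ} {v : V} (hv : v ∈ wt V a) {j k : Fin n}
    (hjk : (j : ℕ) + 1 = k) (h0 : a j - a k ≠ 0) :
    permElt ℚ (Equiv.swap j k) • v + (1 / ((a j - a k : ℤ) : ℚ)) • v ∈
      wt V (a ∘ Equiv.swap j k) := by
  have h0' : (a j : ℚ) - a k ≠ 0 := by exact_mod_cast h0
  intro m
  rw [smul_add, grpAlg_smul_comm, hv m, ← mul_smul]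
  rcases eq_or_ne m k with rfl | hk
  · rw [jucysMurphy_mul_swap ℚ hjk, add_smul, mul_smul, hv j, grpAlg_smul_comm, one_smul]
    simp only [Function.comp, Equiv.swap_apply_right]
    generalize permElt ℚ (Equiv.swap j m) • v = w
    match_scalars
    · ring
    · field_simp; ring
  rcases eq_or_ne m j with rfl | hj
  · rw [jucysMurphy_mul_swap' ℚ hjk, sub_smul, mul_smul, hv k, grpAlg_smul_comm, one_smul]
    simp only [Function.comp, Equiv.swap_apply_left]
    generalize permElt ℚ (Equiv.swap m k) • v = w
    match_scalars
    · ring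
    · field_simp; ring
  · rw [← swap_mul_jucysMurphy_of_ne ℚ hjk hj hk, mul_smul, hv m, grpAlg_smul_comm]
    simp only [Function.comp, Equiv.swap_apply_of_ne_of_ne hj hk]
    rw [smul_add, smul_smul, smul_smul, mul_comm (1 / _ : ℚ)]

theorem swap_smul_smul {W : Type} [AddCommGroup W] [Module (GrpAlg ℚ n) W] (j k : Fin n) (v : W) :
    permElt ℚ (Equiv.swap j k) • permElt ℚ (Equiv.swap j k) • v = v := by
  rw [← mul_smul, permElt_swap_mul_self, one_smul]

/-- The sum of squares of coordinates is averaged over the group; a vanishing sum of rational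
squares has vanishing terms. The form makes vectors of different weights orthogonal. -/
theorem exists_invariant_form [Module.Finite ℚ V] : ∃ B : V →ₗ[ℚ] V →ₗ[ℚ] ℚ,
    (∀ v, B v v = 0 → v = 0) ∧
      ∀ (g : Equiv.Perm (Fin n)) v w, B (permElt ℚ g • v) (permElt ℚ g • w) = B v w := by
  classical
  let b := Module.finBasis ℚ V
  let B : V →ₗ[ℚ] V →ₗ[ℚ] ℚ := ∑ g : Equiv.Perm (Fin n), ∑ i,
    (LinearMap.mul ℚ ℚ).compl₁₂ (b.coord i ∘ₗ actLin V (permElt ℚ g))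
      (b.coord i ∘ₗ actLin V (permElt ℚ g))
  have hB : ∀ v w, B v w = ∑ g : Equiv.Perm (Fin n), ∑ i,
      b.repr (permElt ℚ g • v) i * b.repr (permElt ℚ g • w) i := by
    intro v w
    simp [B, LinearMap.sum_apply]
  refine ⟨B, fun v hv => ?_, fun g v w => ?_⟩
  · rw [hB, Finset.sum_eq_zero_iff_of_nonneg
      (fun _ _ => Finset.sum_nonneg fun _ _ => mul_self_nonneg _)] at hv
    have h := hv 1 (Finset.mem_univ _)
    rw [Finset.sum_eq_zero_iff_of_nonneg (fun _ _ => mul_self_nonneg _)] at h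
    refine b.ext_elem fun i => ?_
    simpa [permElt_one] using h i (Finset.mem_univ _)
  · rw [hB, hB]
    refine Fintype.sum_equiv (Equiv.mulRight g) _ _ fun x => ?_
    simp only [Equiv.coe_mulRight, permElt_mul, mul_smul]

theorem jucysMurphy_symmetric {B : V →ₗ[ℚ] V →ₗ[ℚ] ℚ}
    (hB : ∀ (g : Equiv.Perm (Fin n)) v w, B (permElt ℚ g • v) (permElt ℚ g • w) = B v w)
    (k : Fin n) (v w : V) : B (jucysMurphy ℚ k • v) w = B v (jucysMurphy ℚ k • w) := by
  rw [jucysMurphy, Finset.sum_smul, Finset.sum_smul, map_sum, map_sum, LinearMap.sum_apply]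
  refine Finset.sum_congr rfl fun i _ => ?_
  rw [← hB (Equiv.swap i k) (permElt ℚ (Equiv.swap i k) • v) w, swap_smul_smul]

/-- On a weight vector whose weights at `j` and `k = j + 1` differ by one, the transposition
`(j, k)` acts by a sign. -/
theorem swap_smul_of_abs_eq_one [Module.Finite ℚ V] {a : Fin n → ℤ} {v : V} (hv : v ∈ wt V a)
    {j k : Fin n} (hjk : (j : ℕ) + 1 = k) (h1 : |a j - a k| = 1) :
    permElt ℚ (Equiv.swap j k) • v = -(1 / ((a j - a k : ℤ) : ℚ)) • v := by
  obtain ⟨B, hpos, hB⟩ := exists_invariant_form (n := n) (V := V)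
  have h0 : a j - a k ≠ 0 := fun h => by simp [h] at h1
  have hw := intertwine_mem_wt hv hjk h0
  set h : ℤ := a j - a k with hh
  set σ := permElt ℚ (Equiv.swap j k) with hσ
  set w := σ • v + (1 / (h : ℚ)) • v with hwdef
  have hsq : (1 / (h : ℚ)) * (1 / (h : ℚ)) = 1 := by
    rcases eq_or_eq_neg_of_abs_eq h1 with e | e <;> rw [e] <;> norm_num
  have hσw : σ • w = (1 / (h : ℚ)) • w := by
    rw [hwdef, smul_add, swap_smul_smul, grpAlg_smul_comm, smul_add, smul_smul, hsq, one_smul,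
      add_comm]
  -- `L_k` is symmetric for `B` and acts on `w` by `a j` but on `v` by `a k`, so the two vectors are
  -- orthogonal.
  have hwv : B w v = 0 := by
    have e := jucysMurphy_symmetric hB k w v
    rw [hw k, hv k, map_smul, map_smul, LinearMap.smul_apply] at e
    simp only [Function.comp, Equiv.swap_apply_right, smul_eq_mul] at e
    have h0' : (a j : ℚ) - a k ≠ 0 := by exact_mod_cast h0
    exact (mul_eq_zero.1 (by linear_combination e : ((a j : ℚ) - a k) * B w v = 0)).resolve_left h0'
  -- Since `h = ±1`, the vector `w` is an eigenvector of `σ`, so invariance of `B` moves `σ` onto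
  -- `w`. Then `w` is orthogonal to both summands of itself.
  have hwσ : B w (σ • v) = 0 := by
    rw [← hB (Equiv.swap j k), ← hσ, hσw, swap_smul_smul, map_smul, LinearMap.smul_apply, hwv,
      smul_zero]
  have hw0 : w = 0 := hpos w (by
    nth_rw 2 [hwdef]
    rw [map_add, hwσ, (B w).map_smul, hwv, smul_zero, add_zero])
  rw [neg_smul]
  exact eq_neg_of_add_eq_zero_left hw0

/-! ### The Jucys–Murphy idempotents on weight vectors -/

theorem list_prod_smul_eq_self {W : Type} [AddCommGroup W] [Module (GrpAlg ℚ n) W]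
    {v : W} {l : List (GrpAlg ℚ n)} (h : ∀ x ∈ l, x • v = v) : l.prod • v = v := by
  induction l with
  | nil => simp
  | cons y l ih =>
    rw [List.prod_cons, mul_smul, ih fun x hx => h x (List.mem_cons_of_mem _ hx),
      h y List.mem_cons_self]

theorem list_prod_smul_eq_smul {v : V} {l : List (GrpAlg ℚ n)}
    (h : ∀ x ∈ l, ∃ r : ℚ, x • v = r • v) : ∃ r : ℚ, l.prod • v = r • v := by
  induction l with
  | nil => exact ⟨1, by simp⟩
  | cons y l ih =>
    obtain ⟨r, hr⟩ := ih fun x hx => h x (List.mem_cons_of_mem _ hx)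
    obtain ⟨s, hs⟩ := h y List.mem_cons_self
    exact ⟨r * s, by rw [List.prod_cons, mul_smul, hr, grpAlg_smul_comm, hs, smul_smul]⟩

theorem list_prod_smul_eq_zero {v : V} {l : List (GrpAlg ℚ n)}
    (h : ∀ x ∈ l, ∃ r : ℚ, x • v = r • v) (h0 : ∃ x ∈ l, x • v = 0) : l.prod • v = 0 := by
  induction l with
  | nil => simp at h0
  | cons y l ih =>
    have hl := fun x hx => h x (List.mem_cons_of_mem y hx)
    rw [List.prod_cons, mul_smul]
    obtain ⟨x, hx, hxv⟩ := h0
    rcases List.mem_cons.1 hx with rfl | hx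
    · obtain ⟨r, hr⟩ := list_prod_smul_eq_smul hl
      rw [hr, grpAlg_smul_comm, hxv, smul_zero]
    · rw [ih hl ⟨x, hx, hxv⟩, smul_zero]

theorem jmFactor_smul {a : Fin n → ℤ} {v : V} (hv : v ∈ wt V a) (i : Fin n) (d c : ℤ) :
    (((1 : ℚ) / ((d : ℚ) - (c : ℚ))) • (jucysMurphy ℚ i - algebraMap ℚ (GrpAlg ℚ n) (c : ℚ))) • v
      = (((a i : ℚ) - c) / ((d : ℚ) - c)) • v := by
  rw [smul_assoc, sub_smul, hv i, algebraMap_smul, ← sub_smul, smul_smul]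
  congr 1; ring

theorem jmIdempotent_smul_self {μ : Par n} (t : Tableau μ) {v : V} (hv : v ∈ wt V (content t)) :
    jmIdempotent t • v = v := by
  refine list_prod_smul_eq_self fun x hx => ?_
  obtain ⟨m, -, rfl⟩ := List.mem_map.1 hx
  refine list_prod_smul_eq_self fun x hx => ?_
  obtain ⟨i, -, rfl⟩ := List.mem_map.1 hx
  split_ifs with h
  · exact one_smul _ v
  · rw [jmFactor_smul hv, div_self, one_smul]
    rw [sub_ne_zero]; exact_mod_cast h

theorem jmIdempotent_smul_eq_zero {μ : Par n} (t : Tableau μ) {a : Fin n → ℤ} {v : V}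
    (hv : v ∈ wt V a) (ha : ∀ i, |a i| < n) (hat : a ≠ content t) : jmIdempotent t • v = 0 := by
  obtain ⟨i, hi⟩ := Function.ne_iff.1 hat
  have hfac : ∀ c : ℤ, ∀ x ∈ (List.finRange n).map fun i : Fin n =>
      if content t i = c then (1 : GrpAlg ℚ n)
      else ((1 : ℚ) / ((content t i : ℚ) - (c : ℚ))) •
        (jucysMurphy ℚ i - algebraMap ℚ (GrpAlg ℚ n) (c : ℚ)), ∃ r : ℚ, x • v = r • v := by
    intro c x hx
    obtain ⟨i, -, rfl⟩ := List.mem_map.1 hx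
    split_ifs with h
    · exact ⟨1, by rw [one_smul, one_smul]⟩
    · exact ⟨_, jmFactor_smul hv _ _ _⟩
  refine list_prod_smul_eq_zero ?_ ?_
  · intro x hx
    obtain ⟨m, -, rfl⟩ := List.mem_map.1 hx
    exact list_prod_smul_eq_smul (hfac _)
  · have hai := abs_lt.1 (ha i)
    -- The list index `m` stands for `c = m - (n - 1)`; the bound `|a i| < n` guarantees that `c = a
    -- i` occurs, and its factor at `i` kills `v`.
    refine ⟨_, List.mem_map.2 ⟨(a i + (n - 1)).toNat, ?_, rfl⟩, ?_⟩
    · rw [List.mem_range]; omega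
    · have hc : (((a i + (n - 1)).toNat : ℕ) : ℤ) - ((n : ℤ) - 1) = a i := by omega
      simp only [hc]
      refine list_prod_smul_eq_zero (hfac _) ⟨_, List.mem_map.2 ⟨i, List.mem_finRange i, rfl⟩, ?_⟩
      rw [if_neg (Ne.symm hi), jmFactor_smul hv, sub_self, zero_div, zero_smul]

end Weight

/-! ### Combinatorics of standard tableaux -/

theorem abs_content_lt {n : ℕ} {μ : Par n} (t : Tableau μ) (k : Fin n) : |content t k| < n := by
  have h := cells_subset μ (t k).2
  simp only [Finset.mem_product, Finset.mem_range] at h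
  rw [content, abs_lt]
  omega

theorem permTableau_apply {n : ℕ} {μ : Par n} (j k : Fin n) (t : Tableau μ) (i : Fin n) :
    permTableau (Equiv.swap j k) t i = t (Equiv.swap j k i) := rfl

theorem content_permTableau {n : ℕ} {μ : Par n} (j k : Fin n) (t : Tableau μ) :
    content (permTableau (Equiv.swap j k) t) = content t ∘ Equiv.swap j k := rfl

theorem permTableau_symm {n : ℕ} {μ : Par n} (j k : Fin n) (t : Tableau μ)
    (u : {c : ℕ × ℕ // c ∈ μ.1.cells}) :
    (permTableau (Equiv.swap j k) t).symm u = Equiv.swap j k (t.symm u) := rfl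

theorem permTableau_permTableau {n : ℕ} {μ : Par n} (j k : Fin n) (t : Tableau μ) :
    permTableau (Equiv.swap j k) (permTableau (Equiv.swap j k) t) = t := by
  ext i <;> simp [permTableau_apply]

theorem dPerm_permTableau {n : ℕ} {μ : Par n} (j k : Fin n) (t : Tableau μ) :
    dPerm (permTableau (Equiv.swap j k) t) = Equiv.swap j k * dPerm t := rfl

theorem dPerm_rowTableau {n : ℕ} (μ : Par n) : dPerm (rowTableau μ) = 1 := by
  ext i; simp [dPerm]

/-- The path from `u` to `v` turns at the corner in the row of `u` and the column of `v`, which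
belongs to the diagram. -/
theorem Tableau.IsStandard.symm_le {n : ℕ} {μ : Par n} {t : Tableau μ} (ht : t.IsStandard)
    {u v : {c : ℕ × ℕ // c ∈ μ.1.cells}} (h1 : u.1.1 ≤ v.1.1) (h2 : u.1.2 ≤ v.1.2) :
    t.symm u ≤ t.symm v := by
  have hm : (u.1.1, v.1.2) ∈ μ.1.cells := μ.1.isLowerSet (a := v.1) ⟨h1, le_rfl⟩ v.2
  let w : {c : ℕ × ℕ // c ∈ μ.1.cells} := ⟨_, hm⟩
  have huw : t.symm u ≤ t.symm w := by
    rcases h2.eq_or_lt with h | h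
    · exact le_of_eq (congrArg t.symm (Subtype.ext (Prod.ext rfl h)))
    · exact ((ht u w).1 rfl h).le
  have hwv : t.symm w ≤ t.symm v := by
    rcases h1.eq_or_lt with h | h
    · exact le_of_eq (congrArg t.symm (Subtype.ext (Prod.ext h rfl)))
    · exact ((ht w v).2 rfl h).le
  exact huw.trans hwv

theorem Tableau.IsStandard.le_of_node_le {n : ℕ} {μ : Par n} {t : Tableau μ} (ht : t.IsStandard)
    {a b : Fin n} (h1 : (t a).1.1 ≤ (t b).1.1) (h2 : (t a).1.2 ≤ (t b).1.2) : a ≤ b := by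
  simpa using ht.symm_le h1 h2

/-- Every node of the diagram carries a letter. -/
theorem exists_letter {n : ℕ} {μ : Par n} (t : Tableau μ) {u : ℕ × ℕ} (hu : u ∈ μ.1.cells) :
    ∃ a, (t a).1 = u := ⟨t.symm ⟨u, hu⟩, by simp⟩

theorem node_ne {n : ℕ} {μ : Par n} (t : Tableau μ) {a b : Fin n} (h : a ≠ b) :
    ¬ ((t a).1.1 = (t b).1.1 ∧ (t a).1.2 = (t b).1.2) :=
  fun e => h (t.injective (Subtype.ext (Prod.ext e.1 e.2)))

/-- A standard tableau is determined by its contents. -/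
theorem node_eq_of_content_eq {n : ℕ} {μ ν : Par n} {s : Tableau μ} {t : Tableau ν}
    (hs : s.IsStandard) (ht : t.IsStandard) (h : content s = content t) (k : Fin n) :
    (s k).1 = (t k).1 := by
  induction k using WellFoundedLT.induction with
  | _ k ih =>
    have hk : ((s k).1.2 : ℤ) - (s k).1.1 = (t k).1.2 - (t k).1.1 := congrFun h k
    -- Both nodes of `k` lie on one diagonal, so the one in the higher row lies in the other diagram
    -- as well. Its letter `a` there satisfies `a ≤ k`, and `a < k` would by induction put `a` and
    -- `k` on the same node.
    rcases lt_trichotomy (s k).1.1 (t k).1.1 with hlt | heq | hlt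
    · obtain ⟨a, ha⟩ := exists_letter t (ν.1.isLowerSet
        (a := (t k).1) (b := (s k).1) ⟨hlt.le, by omega⟩ (t k).2)
      have hak : a ≤ k := ht.le_of_node_le (by rw [ha]; omega) (by rw [ha]; omega)
      rcases hak.eq_or_lt with rfl | hak
      · exact ha.symm
      · exact absurd (s.injective (Subtype.ext ((ih a hak).trans ha))) hak.ne
    · exact Prod.ext heq (by omega)
    · obtain ⟨a, ha⟩ := exists_letter s (μ.1.isLowerSet
        (a := (s k).1) (b := (t k).1) ⟨hlt.le, by omega⟩ (s k).2)
      have hak : a ≤ k := hs.le_of_node_le (by rw [ha]; omega) (by rw [ha]; omega)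
      rcases hak.eq_or_lt with rfl | hak
      · exact ha
      · exact absurd (t.injective (Subtype.ext ((ih a hak).symm.trans ha))) hak.ne

theorem std_eq_of_content_eq {n : ℕ} {s t : Std n} (h : content s.2.1 = content t.2.1) :
    s = t := by
  obtain ⟨μ, s, hs⟩ := s
  obtain ⟨ν, t, ht⟩ := t
  have hn := node_eq_of_content_eq hs ht h
  have hμ : μ = ν := by
    refine Subtype.ext (YoungDiagram.ext (Finset.ext fun u => ⟨fun hu => ?_, fun hu => ?_⟩))
    · obtain ⟨a, rfl⟩ := exists_letter s hu
      rw [hn]; exact (t a).2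
    · obtain ⟨a, rfl⟩ := exists_letter t hu
      rw [← hn]; exact (s a).2
  subst hμ
  have : s = t := Equiv.ext fun k => Subtype.ext (hn k)
  subst this
  rfl

theorem stdTableau_eq_of_content_eq {n : ℕ} {μ : Par n} {s t : StdTableau μ}
    (h : content s.1 = content t.1) : s = t :=
  eq_of_heq (Sigma.mk.inj (std_eq_of_content_eq (s := ⟨μ, s⟩) (t := ⟨μ, t⟩) h)).2

/-- If `j` and `k` shared a diagonal, the corner node between them would carry a letter strictly
between two consecutive ones. -/
theorem Tableau.IsStandard.content_sub_ne_zero {n : ℕ} {μ : Par n} {t : Tableau μ}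
    (ht : t.IsStandard) {j k : Fin n} (hjk : (j : ℕ) + 1 = k) :
    content t j - content t k ≠ 0 := by
  intro h
  simp only [content] at h
  have hne := node_ne t (a := j) (b := k) (by omega)
  by_cases hlt : (t j).1.1 < (t k).1.1
  · obtain ⟨a, ha⟩ := exists_letter t (μ.1.isLowerSet
      (a := (t k).1) (b := ((t j).1.1, (t k).1.2)) ⟨hlt.le, le_rfl⟩ (t k).2)
    have h1 : j ≤ a := ht.le_of_node_le (by simp [ha]) (by simp only [ha]; omega)
    have h2 : a ≤ k := ht.le_of_node_le (by simp only [ha]; omega) (by simp [ha])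
    have h3 : a ≠ j := fun e => by
      have := congrArg Prod.snd ha; simp only [e] at this; omega
    have h4 : a ≠ k := fun e => by
      have := congrArg Prod.fst ha; simp only [e] at this; omega
    omega
  · have : k ≤ j := ht.le_of_node_le (by omega) (by omega)
    omega

theorem Tableau.IsStandard.row_lt {n : ℕ} {μ : Par n} {t : Tableau μ} (ht : t.IsStandard)
    {j k : Fin n} (hjk : (j : ℕ) + 1 = k) (h : 1 < content t j - content t k) :
    (t j).1.1 < (t k).1.1 := by
  by_contra hlt
  simp only [content] at h
  have : k ≤ j := ht.le_of_node_le (by omega) (by omega)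
  omega

theorem Tableau.IsStandard.content_sub_lt {n : ℕ} {μ : Par n} {t : Tableau μ} (ht : t.IsStandard)
    {j k : Fin n} (hjk : (j : ℕ) + 1 = k) (h : (t k).1.1 < (t j).1.1) :
    content t j - content t k < -1 := by
  by_contra hlt
  simp only [content] at hlt
  have : k ≤ j := ht.le_of_node_le (by omega) (by omega)
  omega

theorem swap_lt_swap {n : ℕ} {j k : Fin n} (hjk : (j : ℕ) + 1 = k) {a b : Fin n} (hab : a < b)
    (h : ¬ (a = j ∧ b = k)) : Equiv.swap j k a < Equiv.swap j k b := by
  simp only [Equiv.swap_apply_def]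
  split_ifs <;> simp_all <;> omega

/-- Exchanging consecutive letters can violate an inequality only if they share a row or a column.
They must then be adjacent, as a node between them would need an intermediate letter; but adjacent
nodes have contents differing by one. -/
theorem Tableau.IsStandard.permTableau {n : ℕ} {μ : Par n} {t : Tableau μ} (ht : t.IsStandard)
    {j k : Fin n} (hjk : (j : ℕ) + 1 = k) (h : |content t j - content t k| ≠ 1) :
    (permTableau (Equiv.swap j k) t).IsStandard := by
  intro u v
  rw [permTableau_symm, permTableau_symm]
  refine ⟨fun h1 h2 => swap_lt_swap hjk ((ht u v).1 h1 h2) ?_,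
    fun h1 h2 => swap_lt_swap hjk ((ht u v).2 h1 h2) ?_⟩
  · rintro ⟨rfl, rfl⟩
    simp only [content, Equiv.apply_symm_apply] at h
    have hlt : u.1.2 + 1 < v.1.2 := by
      by_contra hc
      apply h
      rw [abs_eq one_pos.le]; omega
    have hw : (u.1.1, u.1.2 + 1) ∈ μ.1.cells := μ.1.isLowerSet (a := v.1) ⟨h1.le, hlt.le⟩ v.2
    have i1 := (ht u ⟨_, hw⟩).1 rfl (Nat.lt_succ_self _)
    have i2 := (ht ⟨_, hw⟩ v).1 h1 hlt
    omega
  · rintro ⟨rfl, rfl⟩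
    simp only [content, Equiv.apply_symm_apply] at h
    have hlt : u.1.1 + 1 < v.1.1 := by
      by_contra hc
      apply h
      rw [abs_eq one_pos.le]; omega
    have hw : (u.1.1 + 1, u.1.2) ∈ μ.1.cells := μ.1.isLowerSet (a := v.1) ⟨hlt.le, h1.le⟩ v.2
    have i1 := (ht u ⟨_, hw⟩).2 rfl (Nat.lt_succ_self _)
    have i2 := (ht ⟨_, hw⟩ v).2 h1 hlt
    omega

/-! ### The row reading tableau -/

theorem rowTableau_strictMono {n : ℕ} (μ : Par n) :
    StrictMono fun k : Fin n => toLex (rowTableau μ k).1 :=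
  ((lexCells μ).orderEmbOfFin (lexCells_card μ)).strictMono

theorem rowTableau_isStandard {n : ℕ} (μ : Par n) : (rowTableau μ).IsStandard := by
  intro u v
  have h := (rowTableau_strictMono μ).lt_iff_lt (a := (rowTableau μ).symm u)
    (b := (rowTableau μ).symm v)
  simp only [Equiv.apply_symm_apply, Prod.Lex.toLex_lt_toLex] at h
  exact ⟨fun h1 h2 => h.1 (Or.inr ⟨h1, h2⟩), fun _ h2 => h.1 (Or.inl h2)⟩

theorem rowTableau_row_mono {n : ℕ} (μ : Par n) {a b : Fin n} (h : a ≤ b) :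
    (rowTableau μ a).1.1 ≤ (rowTableau μ b).1.1 := by
  have := (rowTableau_strictMono μ).monotone h
  simp only [Prod.Lex.toLex_le_toLex] at this
  omega

theorem eq_rowTableau {n : ℕ} {μ : Par n} {t : Tableau μ} (ht : t.IsStandard)
    (h : Monotone fun k => (t k).1.1) : t = rowTableau μ := by
  have hmono : StrictMono fun k : Fin n => toLex (t k).1 := by
    intro a b hab
    simp only [Prod.Lex.toLex_lt_toLex]
    rcases (h hab.le).lt_or_eq with h1 | h1
    · exact Or.inl h1
    · refine Or.inr ⟨h1, ?_⟩
      by_contra hc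
      have := ht.le_of_node_le (a := b) (b := a) h1.ge (not_lt.1 hc)
      omega
  have he := Finset.orderEmbOfFin_unique (lexCells_card μ) (f := fun k => toLex (t k).1)
    (fun k => by simp [lexCells]) hmono
  exact Equiv.ext fun k => Subtype.ext (congrFun he k)

/-- Every standard tableau is obtained from `t^μ` by a sequence of adjacent transpositions each of
which moves down in the dominance order. -/
theorem stdTableau_induction {n : ℕ} {μ : Par n} {P : Tableau μ → Prop}
    (h0 : P (rowTableau μ))
    (hstep : ∀ (s : Tableau μ) (j k : Fin n), s.IsStandard → (j : ℕ) + 1 = k →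
      1 < content s j - content s k → (permTableau (Equiv.swap j k) s).IsStandard →
      P s → P (permTableau (Equiv.swap j k) s)) (t : Tableau μ) (ht : t.IsStandard) : P t := by
  -- The weight `n - k` decreases by one from a letter to the next, so exchanging `j` with `k = j +
  -- 1` when `j` lies in the lower row strictly decreases the sum.
  induction hN : ∑ k : Fin n, (n - (k : ℕ)) * (t k).1.1 using Nat.strong_induction_on
    generalizing t with
  | _ N ih =>
    by_cases hm : Monotone fun k => (t k).1.1
    · rw [eq_rowTableau ht hm]; exact h0
    have hex : ∃ j k : Fin n, (j : ℕ) + 1 = k ∧ (t k).1.1 < (t j).1.1 := by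
      by_contra hcon
      push Not at hcon
      apply hm
      cases n with
      | zero => exact fun a => a.elim0
      | succ n => exact Fin.monotone_iff_le_succ.2 fun i => hcon _ _ (by simp)
    obtain ⟨j, k, hjk, hlt⟩ := hex
    have hc := ht.content_sub_lt hjk hlt
    have hs : (permTableau (Equiv.swap j k) t).IsStandard := ht.permTableau hjk (by
      rw [ne_eq, abs_eq one_pos.le]; omega)
    have hne : j ≠ k := by omega
    have key := hstep (permTableau (Equiv.swap j k) t) j k hs hjk
      (by simp only [content_permTableau, Function.comp, Equiv.swap_apply_left,
            Equiv.swap_apply_right]; omega)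
      (by rwa [permTableau_permTableau])
    rw [permTableau_permTableau] at key
    refine key (ih _ ?_ _ hs rfl)
    rw [← hN]
    simp only [permTableau_apply]
    rw [← Finset.add_sum_erase _ _ (Finset.mem_univ j),
      ← Finset.add_sum_erase _ _ (Finset.mem_erase.2 ⟨hne.symm, Finset.mem_univ k⟩),
      ← Finset.add_sum_erase (a := j) _ _ (Finset.mem_univ j),
      ← Finset.add_sum_erase (a := k) _ _ (Finset.mem_erase.2 ⟨hne.symm, Finset.mem_univ k⟩),
      Equiv.swap_apply_left, Equiv.swap_apply_right, ← add_assoc, ← add_assoc]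
    have hrest : ∑ x ∈ (Finset.univ.erase j).erase k, (n - (x : ℕ)) * (t (Equiv.swap j k x)).1.1 =
        ∑ x ∈ (Finset.univ.erase j).erase k, (n - (x : ℕ)) * (t x).1.1 := by
      refine Finset.sum_congr rfl fun x hx => ?_
      simp only [Finset.mem_erase] at hx
      rw [Equiv.swap_apply_of_ne_of_ne hx.2.1 hx.1]
    rw [hrest, add_lt_add_iff_right]
    have hk : n - (j : ℕ) = (n - (k : ℕ)) + 1 := by omega
    rw [hk]
    nlinarith

/-! ### Dominance of tableaux -/

/-- The number of letters below `m` to which `f` assigns a row with index at most `r`. -/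
def rowCount {n : ℕ} (f : Fin n → ℕ) (m r : ℕ) : ℕ :=
  (Finset.univ.filter fun i : Fin n => (i : ℕ) < m ∧ f i ≤ r).card

/-- Dominance of row assignments. -/
def RowDom {n : ℕ} (g f : Fin n → ℕ) : Prop := ∀ m r, rowCount f m r ≤ rowCount g m r

theorem rowCount_succ {n : ℕ} (f : Fin n → ℕ) (k : Fin n) (r : ℕ) :
    rowCount f (k + 1) r = rowCount f k r + if f k ≤ r then 1 else 0 := by
  have : (Finset.univ.filter fun i : Fin n => (i : ℕ) < k + 1 ∧ f i ≤ r) =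
      (Finset.univ.filter fun i : Fin n => (i : ℕ) < k ∧ f i ≤ r) ∪
        if f k ≤ r then {k} else ∅ := by
    ext i
    split_ifs with h
    · simp only [Finset.mem_filter, Finset.mem_univ, true_and, Finset.mem_union,
        Finset.mem_singleton]
      constructor
      · rintro ⟨h1, h2⟩
        by_cases hi : i = k
        · exact Or.inr hi
        · exact Or.inl ⟨by omega, h2⟩
      · rintro (⟨h1, h2⟩ | rfl)
        · exact ⟨by omega, h2⟩
        · exact ⟨by omega, h⟩
    · simp only [Finset.mem_filter, Finset.mem_univ, true_and, Finset.union_empty]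
      refine ⟨fun ⟨h1, h2⟩ => ⟨?_, h2⟩, fun ⟨h1, h2⟩ => ⟨by omega, h2⟩⟩
      have : i ≠ k := fun e => h (e ▸ h2)
      omega
  rw [rowCount, this, Finset.card_union_of_disjoint, ← rowCount]
  · split_ifs <;> simp
  · split_ifs <;> simp

theorem rowCount_swap {n : ℕ} (f : Fin n → ℕ) {j k : Fin n} (hjk : (j : ℕ) + 1 = k) {m : ℕ}
    (hm : m ≠ k) (r : ℕ) : rowCount (f ∘ Equiv.swap j k) m r = rowCount f m r := by
  refine Finset.card_equiv (Equiv.swap j k) fun i => ?_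
  simp only [Finset.mem_filter, Finset.mem_univ, true_and, Function.comp]
  refine and_congr_left fun _ => ?_
  simp only [Equiv.swap_apply_def]
  split_ifs <;> simp_all <;> omega

theorem rowCount_swap_apply {n : ℕ} (f : Fin n → ℕ) {j k : Fin n} (hjk : (j : ℕ) + 1 = k)
    (r : ℕ) : rowCount (f ∘ Equiv.swap j k) k r = rowCount f j r + if f k ≤ r then 1 else 0 := by
  rw [← hjk, rowCount_succ, rowCount_swap f hjk (by omega)]
  simp

theorem RowDom.refl {n : ℕ} (f : Fin n → ℕ) : RowDom f f := fun _ _ => le_rfl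

theorem RowDom.swap_right {n : ℕ} {g f : Fin n → ℕ} (h : RowDom g f) {j k : Fin n}
    (hjk : (j : ℕ) + 1 = k) (hf : f j < f k) : RowDom g (f ∘ Equiv.swap j k) := by
  intro m r
  rcases eq_or_ne m k with rfl | hm
  · refine le_trans ?_ (h _ r)
    rw [rowCount_swap_apply f hjk, ← hjk, rowCount_succ]
    split_ifs <;> omega
  · rw [rowCount_swap f hjk hm]; exact h m r

/-- Only the count at `m = k` changes. It is controlled by the counts at `j` when `f k > r`, and by
those at `k + 1` when `f k ≤ r`, as then both letters count for `f`. No order of `g j` and `g k` is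
assumed. -/
theorem RowDom.swap_swap {n : ℕ} {g f : Fin n → ℕ} (h : RowDom g f) {j k : Fin n}
    (hjk : (j : ℕ) + 1 = k) (hf : f j < f k) :
    RowDom (g ∘ Equiv.swap j k) (f ∘ Equiv.swap j k) := by
  intro m r
  rcases eq_or_ne m k with rfl | hm
  · rw [rowCount_swap_apply f hjk, rowCount_swap_apply g hjk]
    have h1 := h j r
    have h2 := h (k + 1) r
    rw [rowCount_succ, rowCount_succ, ← hjk, rowCount_succ, rowCount_succ] at h2
    split_ifs at h2 ⊢ <;> omega
  · rw [rowCount_swap f hjk hm, rowCount_swap g hjk hm]; exact h m r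

theorem not_rowDom_swap {n : ℕ} {f : Fin n → ℕ} {j k : Fin n} (hjk : (j : ℕ) + 1 = k)
    (hf : f j < f k) : ¬ RowDom (f ∘ Equiv.swap j k) f := by
  intro h
  have := h k (f j)
  rw [rowCount_swap_apply f hjk, ← hjk, rowCount_succ] at this
  split_ifs at this <;> omega

/-! ### Sums over Young subgroups -/

open scoped Classical in
/-- The sum of the permutations that preserve the fibres of `f`. -/
def youngSum {n : ℕ} (f : Fin n → ℕ) : GrpAlg ℚ n :=
  ∑ σ ∈ Finset.univ.filter (fun σ : Equiv.Perm (Fin n) => ∀ k, f (σ k) = f k), permElt ℚ σ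

theorem rowSum_eq_youngSum {n : ℕ} (μ : Par n) :
    rowSum μ = youngSum fun k => (rowTableau μ k).1.1 := rfl

theorem apply_swap_eq {n : ℕ} {f : Fin n → ℕ} {a b : Fin n} (h : f a = f b) (i : Fin n) :
    f (Equiv.swap a b i) = f i := by
  rw [Equiv.swap_apply_def]
  split_ifs with h1 h2
  · rw [h1, h]
  · rw [h2, h]
  · rfl

theorem permElt_mul_youngSum {n : ℕ} {f : Fin n → ℕ} {τ : Equiv.Perm (Fin n)}
    (hτ : ∀ k, f (τ k) = f k) : permElt ℚ τ * youngSum f = youngSum f := by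
  rw [youngSum, Finset.mul_sum]
  refine Finset.sum_equiv (Equiv.mulLeft τ) (fun σ => ?_) fun σ _ => ?_
  · simp [hτ]
  · rw [Equiv.coe_mulLeft, permElt_mul]

theorem youngSum_mul_permElt {n : ℕ} {f : Fin n → ℕ} {τ : Equiv.Perm (Fin n)}
    (hτ : ∀ k, f (τ k) = f k) : youngSum f * permElt ℚ τ = youngSum f := by
  rw [youngSum, Finset.sum_mul]
  refine Finset.sum_equiv (Equiv.mulRight τ) (fun σ => ?_) fun σ _ => ?_
  · simp only [Finset.mem_filter, Finset.mem_univ, true_and, Equiv.coe_mulRight,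
      Equiv.Perm.mul_apply]
    refine ⟨fun h k => by rw [h, hτ], fun h k => ?_⟩
    have h1 := h (τ⁻¹ k)
    have h2 := hτ (τ⁻¹ k)
    rw [show τ (τ⁻¹ k) = k from τ.apply_symm_apply k] at h1 h2
    rw [h1, h2]
  · rw [Equiv.coe_mulRight, permElt_mul]

theorem youngSum_comp_injective {n : ℕ} (f : Fin n → ℕ) {ρ : ℕ → ℕ} (hρ : Function.Injective ρ) :
    youngSum (ρ ∘ f) = youngSum f := by
  simp only [youngSum, Function.comp, hρ.eq_iff]

theorem youngSum_comp_perm {n : ℕ} (f : Fin n → ℕ) (g : Equiv.Perm (Fin n)) :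
    youngSum (f ∘ g) = permElt ℚ g⁻¹ * youngSum f * permElt ℚ g := by
  rw [youngSum, youngSum, Finset.mul_sum, Finset.sum_mul]
  refine Finset.sum_equiv (MulAut.conj g).toEquiv (fun σ => ?_) fun σ _ => ?_
  · simp only [Finset.mem_filter, Finset.mem_univ, true_and, Function.comp]
    refine ⟨fun h k => by simpa using h (g⁻¹ k), fun h k => by simpa using h (g k)⟩
  · rw [← permElt_mul, ← permElt_mul]
    congr 1
    simp [mul_assoc]

open scoped Classical in
/-- Summation over the Young subgroup of `f` according to the image of the letter `k`. -/
theorem sum_youngSubgroup {n : ℕ} {W : Type} [AddCommGroup W] [Module ℚ W] (f : Fin n → ℕ)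
    (k : Fin n) (F : Equiv.Perm (Fin n) → W)
    (hF : ∀ τ : Equiv.Perm (Fin n), (∀ i, f (τ i) = f i) → F τ = F (Equiv.swap (τ k) k)) :
    ∃ c : ℚ, c ≠ 0 ∧
      ∑ τ ∈ Finset.univ.filter (fun τ : Equiv.Perm (Fin n) => ∀ i, f (τ i) = f i), F τ =
        c • ∑ j ∈ Finset.univ.filter (fun j => f j = f k), F (Equiv.swap j k) := by
  set H := Finset.univ.filter (fun τ : Equiv.Perm (Fin n) => ∀ i, f (τ i) = f i) with hH
  -- The constant is the order of the stabilizer of `k` in the Young subgroup: the permutations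
  -- sending `k` to a given `j` form a coset of it.
  refine ⟨((H.filter fun τ => τ k = k).card : ℚ), ?_, ?_⟩
  · rw [Nat.cast_ne_zero, ← Nat.pos_iff_ne_zero, Finset.card_pos]
    exact ⟨1, by simp [hH]⟩
  · rw [Finset.smul_sum, ← Finset.sum_fiberwise_of_maps_to (s := H)
      (t := Finset.univ.filter fun j => f j = f k) (g := fun τ => τ k)
      (fun τ hτ => by simp only [hH, Finset.mem_filter, Finset.mem_univ, true_and] at hτ ⊢; exact hτ k)]
    refine Finset.sum_congr rfl fun j hj => ?_
    have hj : f j = f k := by simpa using hj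
    rw [Finset.sum_congr rfl (g := fun _ => F (Equiv.swap j k)), Finset.sum_const,
      ← Nat.cast_smul_eq_nsmul ℚ]
    · congr 2
      refine Finset.card_equiv (Equiv.mulLeft (Equiv.swap j k)) fun τ => ?_
      simp only [hH, Finset.mem_filter, Finset.mem_univ, true_and, Equiv.coe_mulLeft,
        Equiv.Perm.mul_apply, apply_swap_eq hj, Equiv.swap_apply_eq_iff, Equiv.swap_apply_right]
    · intro τ hτ
      simp only [hH, Finset.mem_filter, Finset.mem_univ, true_and] at hτ
      rw [hF τ hτ.1, hτ.2]

/-- The product fixes `k`, and away from `k` the function `f` agrees with its update. Thus the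
stabilizer of `k` in the updated Young subgroup lies in that of `f`, which allows its elements to be
absorbed by `youngSum f`. -/
theorem swap_mul_stabilizes {n : ℕ} {f : Fin n → ℕ} {k : Fin n} {q : ℕ}
    {τ : Equiv.Perm (Fin n)}
    (hτ : ∀ i, Function.update f k q (τ i) = Function.update f k q i) (i : Fin n) :
    f ((Equiv.swap (τ k) k * τ) i) = f i := by
  rcases eq_or_ne i k with rfl | hi
  · simp
  · have h1 : (Equiv.swap (τ k) k * τ) i ≠ k := fun h => hi <|
      (Equiv.swap (τ k) k * τ).injective (by rw [h]; simp)
    have h2 := apply_swap_eq (hτ k) (τ i)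
    rwa [hτ i, ← Equiv.Perm.mul_apply, Function.update_of_ne hi, Function.update_of_ne h1] at h2

theorem swap_mul_swap_mul {n : ℕ} (k : Fin n) (τ : Equiv.Perm (Fin n)) :
    permElt ℚ τ = permElt ℚ (Equiv.swap (τ k) k) * permElt ℚ (Equiv.swap (τ k) k * τ) := by
  rw [← permElt_mul, ← mul_assoc, Equiv.swap_mul_self, one_mul]

/-- Moving the letter `k` to row `q`: the product of the two Young sums. -/
theorem youngSum_update_mul {n : ℕ} (f : Fin n → ℕ) (k : Fin n) (q : ℕ) :
    ∃ c : ℚ, c ≠ 0 ∧ youngSum (Function.update f k q) * youngSum f =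
      c • ∑ j ∈ Finset.univ.filter (fun j => Function.update f k q j = q),
        permElt ℚ (Equiv.swap j k) * youngSum f := by
  obtain ⟨c, hc, h⟩ := sum_youngSubgroup (Function.update f k q) k
    (fun τ => permElt ℚ τ * youngSum f) fun τ hτ => by
      rw [swap_mul_swap_mul k τ, mul_assoc, permElt_mul_youngSum (swap_mul_stabilizes hτ)]
  refine ⟨c, hc, ?_⟩
  rw [Function.update_self] at h
  rw [← h, ← Finset.sum_mul]
  rfl

theorem youngSum_mul_update {n : ℕ} (f : Fin n → ℕ) (k : Fin n) (q : ℕ) :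
    ∃ c : ℚ, c ≠ 0 ∧ youngSum f * youngSum (Function.update f k q) =
      c • ∑ j ∈ Finset.univ.filter (fun j => Function.update f k q j = q),
        youngSum f * permElt ℚ (Equiv.swap j k) := by
  classical
  obtain ⟨c, hc, h⟩ := sum_youngSubgroup (Function.update f k q) k
    (fun τ => youngSum f * permElt ℚ τ⁻¹) fun τ hτ => by
      have h1 : τ⁻¹ = (Equiv.swap (τ k) k * τ)⁻¹ * Equiv.swap (τ k) k := by
        rw [mul_inv_rev, Equiv.swap_inv, mul_assoc, Equiv.swap_mul_self, mul_one]
      have h2 : ∀ i, f ((Equiv.swap (τ k) k * τ)⁻¹ i) = f i := fun i => by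
        rw [← swap_mul_stabilizes hτ, show (Equiv.swap (τ k) k * τ)
          ((Equiv.swap (τ k) k * τ)⁻¹ i) = i from Equiv.apply_symm_apply _ i]
      rw [h1, permElt_mul, ← mul_assoc, youngSum_mul_permElt h2, Equiv.swap_inv]
  refine ⟨c, hc, ?_⟩
  rw [Function.update_self] at h
  simp only [Equiv.swap_inv] at h
  rw [← h, ← Finset.mul_sum]
  congr 1
  refine Finset.sum_equiv (Equiv.inv _) (fun τ => ?_) fun τ _ => ?_
  · simp only [Finset.mem_filter, Finset.mem_univ, true_and, Equiv.inv_apply]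
    refine ⟨fun h i => ?_, fun h i => ?_⟩
    · have h3 := h (τ⁻¹ i)
      rwa [show τ (τ⁻¹ i) = i from τ.apply_symm_apply i, eq_comm] at h3
    · have h3 := h (τ i)
      rwa [show τ⁻¹ (τ i) = i from τ.symm_apply_apply i, eq_comm] at h3
  · rw [Equiv.inv_apply, inv_inv]

/-! ### Raising a node -/

theorem exists_perm_of_card_fiber_eq {n : ℕ} {f g : Fin n → ℕ}
    (h : ∀ c, (Finset.univ.filter fun i => f i = c).card =
      (Finset.univ.filter fun i => g i = c).card) :
    ∃ σ : Equiv.Perm (Fin n), f = g ∘ σ := by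
  have e : ∀ c, Nonempty ({i // f i = c} ≃ {i // g i = c}) := fun c =>
    ⟨Fintype.equivOfCardEq (by rw [Fintype.card_subtype, Fintype.card_subtype, h])⟩
  exact ⟨Equiv.ofFiberEquiv fun c => (e c).some, funext fun i =>
    (Equiv.ofFiberEquiv_map _ i).symm⟩

theorem card_row_fiber {n : ℕ} {μ : Par n} (t : Tableau μ) (i : ℕ) :
    (Finset.univ.filter fun k => (t k).1.1 = i).card = μ.1.rowLen i := by
  rw [YoungDiagram.rowLen_eq_card]
  refine Finset.card_bij (fun k _ => (t k).1) (fun k hk => ?_) (fun a _ b _ h => ?_) fun u hu => ?_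
  · exact YoungDiagram.mem_row_iff.2 ⟨(t k).2, by simpa using hk⟩
  · exact t.injective (Subtype.ext h)
  · obtain ⟨h1, h2⟩ := YoungDiagram.mem_row_iff.1 hu
    obtain ⟨a, rfl⟩ := exists_letter t h1
    exact ⟨a, by simpa using h2, rfl⟩

/-- The partition obtained by moving the last node of row `r` to the end of a row of the same
length as row `q`, up to the order of rows of equal length. -/
theorem exists_raised {n : ℕ} (μ : Par n) {q r : ℕ} (hqr : q < r) (hr : 0 < μ.1.rowLen r) :
    ∃ (ν : Par n) (q' r' : ℕ), q' ≤ q ∧ r ≤ r' ∧ μ.1.rowLen q' = μ.1.rowLen q ∧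
      μ.1.rowLen r' = μ.1.rowLen r ∧ (∀ i, ν.1.rowLen i + (if i = r' then 1 else 0) =
        μ.1.rowLen i + if i = q' then 1 else 0) := by
  set b := μ.1.rowLen q with hb
  set d := μ.1.rowLen r - 1 with hd
  -- Here `q'` is the first row of the length of row `q` and `r'` the last row of the length of row
  -- `r`, so adding a node to the former and removing one from the latter again gives a Young
  -- diagram.
  set q' := μ.1.colLen b with hq'
  set r' := μ.1.colLen d - 1 with hr'
  have hqq : q' ≤ q := by
    by_contra h
    have := YoungDiagram.mem_iff_lt_rowLen.1 (YoungDiagram.mem_iff_lt_colLen.2 (not_le.1 h))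
    omega
  have hrc : r < μ.1.colLen d :=
    YoungDiagram.mem_iff_lt_colLen.1 (YoungDiagram.mem_iff_lt_rowLen.2 (by omega))
  have hq'b : μ.1.rowLen q' = b := by
    refine le_antisymm ?_ (μ.1.rowLen_anti _ _ hqq)
    by_contra h
    have := YoungDiagram.mem_iff_lt_colLen.1 (YoungDiagram.mem_iff_lt_rowLen.2 (not_le.1 h))
    omega
  have hr'd : μ.1.rowLen r' = μ.1.rowLen r := by
    refine le_antisymm (μ.1.rowLen_anti _ _ (by omega)) ?_
    have := YoungDiagram.mem_iff_lt_rowLen.1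
      (YoungDiagram.mem_iff_lt_colLen.2 (show r' < μ.1.colLen d by omega))
    omega
  have hmem : (r', d) ∈ μ.1.cells :=
    (YoungDiagram.mem_cells _).2 (YoungDiagram.mem_iff_lt_rowLen.2 (by omega))
  have hnot : (q', b) ∉ μ.1.cells := fun h => by
    have := YoungDiagram.mem_iff_lt_rowLen.1 ((YoungDiagram.mem_cells _).1 h)
    omega
  let ν : YoungDiagram :=
    { cells := insert (q', b) (μ.1.cells.erase (r', d))
      isLowerSet := by
        rintro ⟨v1, v2⟩ ⟨u1, u2⟩ ⟨h1, h2⟩ hv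
        simp only [Finset.coe_insert, Set.mem_insert_iff, Finset.mem_coe, Finset.mem_erase, ne_eq,
          Prod.mk.injEq, YoungDiagram.mem_cells, YoungDiagram.mem_iff_lt_rowLen] at h1 h2 hv ⊢
        rcases hv with ⟨rfl, rfl⟩ | ⟨hne, hv⟩
        · by_cases hu1 : u1 = q'
          · subst hu1; omega
          · right
            have := YoungDiagram.mem_iff_lt_rowLen.1
              (YoungDiagram.mem_iff_lt_colLen.2 (show u1 < μ.1.colLen b by omega))
            omega
        · right
          have h3 := μ.1.rowLen_anti _ _ h1
          refine ⟨?_, by omega⟩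
          rintro ⟨rfl, rfl⟩
          have := YoungDiagram.mem_iff_lt_colLen.1 (YoungDiagram.mem_iff_lt_rowLen.2
            (show d < μ.1.rowLen v1 by omega))
          have : v1 = r' := by omega
          subst this
          omega }
  have hν : ν.cells = insert (q', b) (μ.1.cells.erase (r', d)) := rfl
  have hcard : ν.card = n := by
    have := Finset.card_pos.2 ⟨_, hmem⟩
    rw [YoungDiagram.card, hν, Finset.card_insert_of_notMem
      (fun h => hnot (Finset.mem_of_mem_erase h)), Finset.card_erase_of_mem hmem,
      Nat.sub_add_cancel this]
    exact μ.2
  refine ⟨⟨ν, hcard⟩, q', r', hqq, by omega, hq'b, hr'd, fun i => ?_⟩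
  have hrow : ∀ κ : YoungDiagram, κ.rowLen i = (κ.cells.filter fun c => c.1 = i).card :=
    fun κ => YoungDiagram.rowLen_eq_card κ
  simp only [hrow, hν, Finset.filter_insert, Finset.filter_erase]
  by_cases h1 : q' = i
  · subst h1
    rw [if_pos rfl, if_pos rfl, if_neg (by omega), Finset.card_insert_of_notMem (by
      simp only [Finset.mem_erase, Finset.mem_filter]; tauto), Finset.erase_eq_of_notMem (by
      simp only [Finset.mem_filter]; omega)]
  · rw [if_neg h1, if_neg (Ne.symm h1)]
    by_cases h2 : i = r'
    · subst h2
      have hm : (r', d) ∈ μ.1.cells.filter fun c => c.1 = r' := by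
        simp only [Finset.mem_filter, and_true]; exact hmem
      rw [if_pos rfl, Finset.card_erase_of_mem hm,
        Nat.sub_add_cancel (Finset.card_pos.2 ⟨_, hm⟩), add_zero]
    · rw [if_neg h2, Finset.erase_eq_of_notMem (by
        simp only [Finset.mem_filter]; omega)]

/-- Moving a letter from row `r` to a higher row `q` raises the shape in the dominance order. -/
theorem youngSum_update_mem {n : ℕ} (μ : Par n) (k : Fin n) {q : ℕ}
    (hq : q < (rowTableau μ k).1.1) :
    youngSum (Function.update (fun i => (rowTableau μ i).1.1) k q) ∈ higherIdeal μ := by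
  classical
  set f : Fin n → ℕ := fun i => (rowTableau μ i).1.1 with hf
  set r := f k with hr
  have hrow : 0 < μ.1.rowLen r := by
    have := YoungDiagram.mem_iff_lt_rowLen.1 ((YoungDiagram.mem_cells _).1 (rowTableau μ k).2)
    exact (Nat.zero_le _).trans_lt this
  have hqr : q < r := hq
  obtain ⟨ν, q', r', hq', hr', hlq, hlr, hν⟩ := exists_raised μ hqr hrow
  have hdom : StrictlyDominates ν μ := by
    refine ⟨fun h => ?_, fun m => ?_⟩
    · have := hν q'
      rw [h, if_pos rfl, if_neg (by omega)] at this
      omega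
    · have h := Finset.sum_congr (rfl : Finset.range m = Finset.range m) fun i _ => hν i
      rw [Finset.sum_add_distrib, Finset.sum_add_distrib, Finset.sum_ite_eq', Finset.sum_ite_eq']
        at h
      simp only [Finset.mem_range] at h
      split_ifs at h <;> omega
  have hmem : youngSum (fun i => (rowTableau ν i).1.1) ∈ TwoSidedIdeal.span
      {a | ∃ ν : Par n, StrictlyDominates ν μ ∧
        ∃ s t : StdTableau ν, a = murphyElt s.1 t.1} := by
    refine TwoSidedIdeal.subset_span ⟨ν, hdom, ⟨_, rowTableau_isStandard ν⟩,
      ⟨_, rowTableau_isStandard ν⟩, ?_⟩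
    rw [murphyElt, dPerm_rowTableau, inv_one, permElt_one, one_mul, mul_one, rowSum_eq_youngSum]
  -- Relabelling the rows leaves a Young sum unchanged. After relabelling by `ρ` the fibres have the
  -- sizes of the rows of `ν`, so the Young sum is conjugate to `x_ν`.
  set ρ : Equiv.Perm ℕ := Equiv.swap q q' * Equiv.swap r r' with hρ
  have hρq : ρ q = q' := by
    rw [hρ, Equiv.Perm.mul_apply, Equiv.swap_apply_of_ne_of_ne (a := r) (b := r') (x := q)
      (by omega) (by omega), Equiv.swap_apply_left]
  have hρr : ρ r = r' := by
    rw [hρ, Equiv.Perm.mul_apply, Equiv.swap_apply_left,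
      Equiv.swap_apply_of_ne_of_ne (a := q) (b := q') (x := r') (by omega) (by omega)]
  have hlen : ∀ i, μ.1.rowLen (ρ i) = μ.1.rowLen i := fun i => by
    rw [hρ, Equiv.Perm.mul_apply]
    simp only [Equiv.swap_apply_def]
    split_ifs <;> simp_all
  have hcard : ∀ i, (Finset.univ.filter fun j => Function.update f k q j = i).card +
      (if i = r then 1 else 0) = μ.1.rowLen i + if i = q then 1 else 0 := by
    intro i
    rw [← card_row_fiber (rowTableau μ) i]
    change _ = (Finset.univ.filter fun j => f j = i).card + _
    simp only [Finset.card_filter]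
    rw [← Finset.add_sum_erase _ _ (Finset.mem_univ k),
      ← Finset.add_sum_erase (a := k) _ (fun j => if f j = i then 1 else 0) (Finset.mem_univ k),
      Function.update_self, ← hr, Finset.sum_congr rfl fun j hj => by
        rw [Function.update_of_ne (Finset.ne_of_mem_erase hj)]]
    simp only [eq_comm (a := i)]
    omega
  obtain ⟨g, hg⟩ := exists_perm_of_card_fiber_eq (f := ρ ∘ Function.update f k q)
    (g := fun i => (rowTableau ν i).1.1) (fun c => by
      obtain ⟨i, rfl⟩ := ρ.surjective c
      rw [card_row_fiber (rowTableau ν)]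
      have h1 := hν (ρ i)
      have h2 := hcard i
      simp only [hlen, ← hρq, ← hρr, ρ.injective.eq_iff, Function.comp] at h1 h2 ⊢
      omega)
  rw [← youngSum_comp_injective _ ρ.injective, hg, youngSum_comp_perm]
  exact TwoSidedIdeal.mul_mem_right _ _ _ (TwoSidedIdeal.mul_mem_left _ _ _ hmem)

/-! ### The generator is a weight vector -/

theorem toQuot_eq_zero {n : ℕ} {μ : Par n} {a : GrpAlg ℚ n} :
    toQuot μ a = 0 ↔ a ∈ higherIdeal μ :=
  Submodule.Quotient.mk_eq_zero _

theorem toQuot_add {n : ℕ} (μ : Par n) (a b : GrpAlg ℚ n) :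
    toQuot μ (a + b) = toQuot μ a + toQuot μ b := rfl

/-- The quotient map as a rational linear map. -/
def toQuotLin {n : ℕ} (μ : Par n) : GrpAlg ℚ n →ₗ[ℚ] HigherQuot μ where
  toFun := toQuot μ
  map_add' := toQuot_add μ
  map_smul' r a := by
    rw [Algebra.smul_def, ← smul_toQuot, algebraMap_smul, RingHom.id_apply]

@[simp] theorem toQuotLin_apply {n : ℕ} (μ : Par n) (a : GrpAlg ℚ n) :
    toQuotLin μ a = toQuot μ a := rfl

theorem toQuotLin_surjective {n : ℕ} (μ : Par n) : Function.Surjective (toQuotLin μ) :=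
  Submodule.Quotient.mk_surjective _

instance finite_higherQuot {n : ℕ} (μ : Par n) : Module.Finite ℚ (HigherQuot μ) :=
  have : Module.Finite ℚ (GrpAlg ℚ n) :=
    Module.Finite.equiv (MonoidAlgebra.coeffLinearEquiv ℚ).symm
  Module.Finite.of_surjective _ (toQuotLin_surjective μ)

/-- Summing over the letters before `k` in the row reading tableau. -/
theorem sum_lt_eq_content_smul {n : ℕ} (μ : Par n) {W : Type} [AddCommGroup W] (k : Fin n)
    (F : Fin n → W) (e : W)
    (h1 : ∀ j, (rowTableau μ j).1.1 = (rowTableau μ k).1.1 → F j = e)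
    (h2 : ∀ q, q < (rowTableau μ k).1.1 →
      ∑ j ∈ Finset.univ.filter (fun j => (rowTableau μ j).1.1 = q), F j + e = 0) :
    ∑ j ∈ Finset.univ.filter (fun j => j < k), F j = content (rowTableau μ) k • e := by
  classical
  have hst := rowTableau_isStandard μ
  rw [← Finset.sum_filter_add_sum_filter_not _
    (fun j => (rowTableau μ j).1.1 = (rowTableau μ k).1.1), Finset.filter_filter,
    Finset.filter_filter, Finset.sum_congr rfl (g := fun _ => e)
    (fun j hj => h1 j (by simp only [Finset.mem_filter] at hj; exact hj.2.2)), Finset.sum_const]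
  -- The letters before `k` are those to its left in its row, each contributing `e`, and those in
  -- the rows above, each row contributing `-e` in total. This gives column minus row.
  have hc : (Finset.univ.filter fun j : Fin n =>
      j < k ∧ (rowTableau μ j).1.1 = (rowTableau μ k).1.1).card = (rowTableau μ k).1.2 := by
    rw [← Finset.card_range (rowTableau μ k).1.2]
    refine Finset.card_bij (fun j _ => (rowTableau μ j).1.2) (fun j hj => ?_)
      (fun a ha b hb h => ?_) fun c hc => ?_
    · simp only [Finset.mem_filter, Finset.mem_univ, true_and] at hj
      rw [Finset.mem_range]
      by_contra h
      have := hst.le_of_node_le (a := k) (b := j) hj.2.ge (not_lt.1 h)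
      omega
    · simp only [Finset.mem_filter, Finset.mem_univ, true_and] at ha hb
      exact (rowTableau μ).injective (Subtype.ext (Prod.ext (ha.2.trans hb.2.symm) h))
    · rw [Finset.mem_range] at hc
      obtain ⟨a, ha⟩ := exists_letter (rowTableau μ) (μ.1.isLowerSet
        (a := (rowTableau μ k).1) (b := ((rowTableau μ k).1.1, c)) ⟨le_rfl, hc.le⟩
        (rowTableau μ k).2)
      refine ⟨a, ?_, by rw [ha]⟩
      simp only [Finset.mem_filter, Finset.mem_univ, true_and, ha, and_true]
      refine lt_of_le_of_ne (hst.le_of_node_le (by rw [ha]) (by rw [ha]; exact hc.le)) ?_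
      rintro rfl
      rw [ha] at hc
      exact lt_irrefl _ hc
  have hr : ∑ j ∈ Finset.univ.filter (fun j : Fin n =>
      j < k ∧ ¬ (rowTableau μ j).1.1 = (rowTableau μ k).1.1), F j =
      -((rowTableau μ k).1.1 • e) := by
    have hs : (Finset.univ.filter fun j : Fin n =>
        j < k ∧ ¬ (rowTableau μ j).1.1 = (rowTableau μ k).1.1) =
        Finset.univ.filter fun j => (rowTableau μ j).1.1 ∈ Finset.range (rowTableau μ k).1.1 := by
      ext j
      simp only [Finset.mem_filter, Finset.mem_univ, true_and, Finset.mem_range]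
      refine ⟨fun h => lt_of_le_of_ne (rowTableau_row_mono μ h.1.le) h.2, fun h => ⟨?_, h.ne⟩⟩
      by_contra hjk
      exact absurd (rowTableau_row_mono μ (not_lt.1 hjk)) (not_le.2 h)
    rw [hs, ← Finset.sum_fiberwise_of_maps_to (t := Finset.range (rowTableau μ k).1.1)
      (g := fun j => (rowTableau μ j).1.1) (fun j hj => by simpa using hj)]
    rw [Finset.sum_congr rfl (g := fun _ => -e), Finset.sum_const, Finset.card_range, smul_neg]
    intro q hq
    rw [← eq_neg_of_add_eq_zero_left (h2 q (Finset.mem_range.1 hq))]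
    refine Finset.sum_congr (Finset.ext fun j => ?_) fun _ _ => rfl
    simp only [Finset.mem_filter, Finset.mem_univ, true_and, Finset.mem_range] at hq ⊢
    exact ⟨fun h => h.2, fun h => ⟨h ▸ hq, h⟩⟩
  rw [hc, hr, content, sub_smul, natCast_zsmul, natCast_zsmul, sub_eq_add_neg]

theorem filter_update_eq {n : ℕ} (f : Fin n → ℕ) (k : Fin n) (q : ℕ) :
    (Finset.univ.filter fun j => Function.update f k q j = q) =
      insert k (Finset.univ.filter fun j => f j = q) := by
  ext j
  simp only [Finset.mem_filter, Finset.mem_univ, true_and, Finset.mem_insert,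
    Function.update_apply]
  split_ifs with h <;> simp [h]

/-- For a row `q` above that of `k`, the Young sum with `k` moved to row `q` lies in the higher
ideal. Multiplied by `x_μ` it is a nonzero multiple of `x_μ` plus the sum of the `(j, k) x_μ` over
the letters `j` of row `q`, so this combination vanishes in the quotient. -/
theorem jucysMurphy_mul_rowSum {n : ℕ} (μ : Par n) (k : Fin n) :
    toQuot μ (jucysMurphy ℚ k * rowSum μ) = content (rowTableau μ) k • toQuot μ (rowSum μ) := by
  have h := sum_lt_eq_content_smul μ k
    (fun j => toQuot μ (permElt ℚ (Equiv.swap j k) * rowSum μ)) (toQuot μ (rowSum μ))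
    (fun j hj => by
      rw [rowSum_eq_youngSum, permElt_mul_youngSum
        (apply_swap_eq (f := fun k => (rowTableau μ k).1.1) hj)])
    (fun q hq => by
      obtain ⟨c, hc, h⟩ := youngSum_update_mul (fun k => (rowTableau μ k).1.1) k q
      have h0 : toQuot μ (youngSum (Function.update (fun k => (rowTableau μ k).1.1) k q) *
          rowSum μ) = 0 :=
        toQuot_eq_zero.2 (TwoSidedIdeal.mul_mem_right _ _ _ (youngSum_update_mem μ k hq))
      rw [rowSum_eq_youngSum, h, ← toQuotLin_apply, map_smul, smul_eq_zero_iff_right hc,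
        filter_update_eq, Finset.sum_insert (by simpa using hq.ne'),
        Equiv.swap_self] at h0
      rw [← h0, map_add, add_comm, map_sum]
      congr 1
      change _ = toQuot μ (permElt ℚ 1 * _)
      rw [permElt_one, one_mul, rowSum_eq_youngSum])
  rw [← h, jucysMurphy, Finset.sum_mul, ← toQuotLin_apply, map_sum]
  rfl

theorem rowSum_mul_jucysMurphy {n : ℕ} (μ : Par n) (k : Fin n) :
    toQuot μ (rowSum μ * jucysMurphy ℚ k) = content (rowTableau μ) k • toQuot μ (rowSum μ) := by
  have h := sum_lt_eq_content_smul μ k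
    (fun j => toQuot μ (rowSum μ * permElt ℚ (Equiv.swap j k))) (toQuot μ (rowSum μ))
    (fun j hj => by
      rw [rowSum_eq_youngSum, youngSum_mul_permElt
        (apply_swap_eq (f := fun k => (rowTableau μ k).1.1) hj)])
    (fun q hq => by
      obtain ⟨c, hc, h⟩ := youngSum_mul_update (fun k => (rowTableau μ k).1.1) k q
      have h0 : toQuot μ (rowSum μ * youngSum (Function.update
          (fun k => (rowTableau μ k).1.1) k q)) = 0 :=
        toQuot_eq_zero.2 (TwoSidedIdeal.mul_mem_left _ _ _ (youngSum_update_mem μ k hq))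
      rw [rowSum_eq_youngSum, h, ← toQuotLin_apply, map_smul, smul_eq_zero_iff_right hc,
        filter_update_eq, Finset.sum_insert (by simpa using hq.ne'),
        Equiv.swap_self] at h0
      rw [← h0, map_add, add_comm, map_sum]
      congr 1
      change _ = toQuot μ (_ * permElt ℚ 1)
      rw [permElt_one, mul_one, rowSum_eq_youngSum])
  rw [← h, jucysMurphy, Finset.mul_sum, ← toQuotLin_apply, map_sum]
  rfl

theorem rowSum_mem_wt {n : ℕ} (μ : Par n) :
    toQuot μ (rowSum μ) ∈ wt (HigherQuot μ) (content (rowTableau μ)) := by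
  intro k
  rw [smul_toQuot, jucysMurphy_mul_rowSum, Int.cast_smul_eq_zsmul]

theorem toQuot_mul_right {n : ℕ} {μ : Par n} {a b : GrpAlg ℚ n} (h : toQuot μ a = toQuot μ b)
    (c : GrpAlg ℚ n) : toQuot μ (a * c) = toQuot μ (b * c) := by
  have h1 : a - b ∈ higherIdeal μ := (Submodule.Quotient.eq _).1 h
  refine (Submodule.Quotient.eq _).2 ?_
  rw [← sub_mul]
  exact TwoSidedIdeal.mul_mem_right _ _ _ h1

theorem toQuot_mul_list_prod {n : ℕ} {μ : Par n} {a : GrpAlg ℚ n} {l : List (GrpAlg ℚ n)}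
    (h : ∀ x ∈ l, toQuot μ (a * x) = toQuot μ a) : toQuot μ (a * l.prod) = toQuot μ a := by
  induction l with
  | nil => simp
  | cons y l ih =>
    rw [List.prod_cons, ← mul_assoc, toQuot_mul_right (h y List.mem_cons_self),
      ih fun x hx => h x (List.mem_cons_of_mem _ hx)]

theorem rowSum_mul_jmIdempotent {n : ℕ} (μ : Par n) :
    toQuot μ (rowSum μ * jmIdempotent (rowTableau μ)) = toQuot μ (rowSum μ) := by
  refine toQuot_mul_list_prod fun x hx => ?_
  obtain ⟨m, -, rfl⟩ := List.mem_map.1 hx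
  refine toQuot_mul_list_prod fun x hx => ?_
  obtain ⟨i, -, rfl⟩ := List.mem_map.1 hx
  split_ifs with h
  · rw [mul_one]
  · rw [mul_smul_comm, mul_sub, ← Algebra.commutes, ← Algebra.smul_def, ← toQuotLin_apply,
      map_smul, map_sub, map_smul, toQuotLin_apply, rowSum_mul_jucysMurphy, toQuotLin_apply,
      ← Int.cast_smul_eq_zsmul ℚ, ← sub_smul, smul_smul, one_div, inv_mul_cancel₀, one_smul]
    rw [sub_ne_zero]; exact_mod_cast h

/-- The right idempotent in the definition of `ξ_s` is absorbed by `x_μ`, which is a weight vector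
from the right too. What remains is visibly in the left module generated by `x_μ`. -/
theorem seminormal_eq {n : ℕ} {μ : Par n} (s : Tableau μ) :
    seminormal s = jmIdempotent s • permElt ℚ (dPerm s) • toQuot μ (rowSum μ) := by
  rw [seminormal, murphyElt, dPerm_rowTableau, inv_one, permElt_one, mul_one, mul_assoc,
    mul_assoc, ← smul_toQuot, ← smul_toQuot, rowSum_mul_jmIdempotent]

/-! ### Triangularity and the seminormal basis -/

/-- The assignment of rows to letters. -/
def rowOf {n : ℕ} {μ : Par n} (t : Tableau μ) (k : Fin n) : ℕ := (t k).1.1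

theorem rowOf_permTableau {n : ℕ} {μ : Par n} (j k : Fin n) (t : Tableau μ) :
    rowOf (permTableau (Equiv.swap j k) t) = rowOf t ∘ Equiv.swap j k := rfl

/-- The span of the weight spaces of the standard tableaux dominating `s`. -/
def domSpan {n : ℕ} {μ : Par n} (s : Tableau μ) : Submodule ℚ (HigherQuot μ) :=
  ⨆ u : {u : StdTableau μ // RowDom (rowOf u.1) (rowOf s)}, wt (HigherQuot μ) (content u.1.1)

theorem wt_le_domSpan {n : ℕ} {μ : Par n} {s u : Tableau μ} (hu : u.IsStandard)
    (h : RowDom (rowOf u) (rowOf s)) : wt (HigherQuot μ) (content u) ≤ domSpan s :=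
  le_iSup (fun u : {u : StdTableau μ // RowDom (rowOf u.1) (rowOf s)} =>
    wt (HigherQuot μ) (content u.1.1)) ⟨⟨u, hu⟩, h⟩

theorem domSpan_le {n : ℕ} {μ : Par n} {s : Tableau μ} {N : Submodule ℚ (HigherQuot μ)}
    (h : ∀ u : Tableau μ, u.IsStandard → RowDom (rowOf u) (rowOf s) →
      wt (HigherQuot μ) (content u) ≤ N) : domSpan s ≤ N :=
  iSup_le fun u => h u.1.1 u.1.2 u.2

theorem smul_mem_of_mem_domSpan {n : ℕ} {μ : Par n} {s : Tableau μ} {a : GrpAlg ℚ n}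
    {N : Submodule ℚ (HigherQuot μ)}
    (h : ∀ u : Tableau μ, u.IsStandard → RowDom (rowOf u) (rowOf s) →
      ∀ v ∈ wt (HigherQuot μ) (content u), a • v ∈ N) {v : HigherQuot μ} (hv : v ∈ domSpan s) :
    a • v ∈ N :=
  Submodule.mem_comap.1 (domSpan_le (N := N.comap (actLin (HigherQuot μ) a))
    (fun u hu hus v hv => Submodule.mem_comap.2 (h u hu hus v hv)) hv)

theorem eq_of_mem_domSpan {n : ℕ} {μ : Par n} {s : Tableau μ}
    {A B : HigherQuot μ →ₗ[ℚ] HigherQuot μ}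
    (h : ∀ u : Tableau μ, u.IsStandard → RowDom (rowOf u) (rowOf s) →
      ∀ v ∈ wt (HigherQuot μ) (content u), A v = B v) {v : HigherQuot μ} (hv : v ∈ domSpan s) :
    A v = B v :=
  LinearMap.mem_eqLocus.1 (domSpan_le (N := LinearMap.eqLocus A B)
    (fun u hu hus v hv => LinearMap.mem_eqLocus.2 (h u hu hus v hv)) hv)

/-- A transposition sends a vector of weight `u` to a combination of vectors of weights `u` and `(j,
k) u`. When `(j, k) u` could fail to be standard, the transposition acts by a sign, so no new weight
occurs. -/
theorem swap_smul_mem_domSpan {n : ℕ} {μ : Par n} {s : Tableau μ} {j k : Fin n}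
    (hjk : (j : ℕ) + 1 = k) (hs : rowOf s j < rowOf s k) {v : HigherQuot μ} (hv : v ∈ domSpan s) :
    permElt ℚ (Equiv.swap j k) • v ∈ domSpan (permTableau (Equiv.swap j k) s) := by
  refine smul_mem_of_mem_domSpan (fun u hu hus v hv => ?_) hv
  have hle : wt (HigherQuot μ) (content u) ≤ domSpan (permTableau (Equiv.swap j k) s) :=
    wt_le_domSpan hu (hus.swap_right hjk hs)
  by_cases h1 : |content u j - content u k| = 1
  · rw [swap_smul_of_abs_eq_one hv hjk h1]
    exact Submodule.smul_mem _ _ (hle hv)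
  · have hle' : wt (HigherQuot μ) (content (permTableau (Equiv.swap j k) u)) ≤
        domSpan (permTableau (Equiv.swap j k) s) :=
      wt_le_domSpan (hu.permTableau hjk h1) (hus.swap_swap hjk hs)
    exact (Submodule.add_mem_iff_left _ (Submodule.smul_mem _ _ (hle hv))).1
      (hle' (intertwine_mem_wt hv hjk (hu.content_sub_ne_zero hjk)))

theorem dPerm_smul_mem_domSpan {n : ℕ} {μ : Par n} (t : Tableau μ) (ht : t.IsStandard) :
    permElt ℚ (dPerm t) • toQuot μ (rowSum μ) ∈ domSpan t := by
  refine stdTableau_induction (P := fun t => permElt ℚ (dPerm t) • toQuot μ (rowSum μ) ∈ domSpan t)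
    ?_ ?_ t ht
  · rw [dPerm_rowTableau, permElt_one, one_smul]
    exact wt_le_domSpan (rowTableau_isStandard μ) (RowDom.refl _) (rowSum_mem_wt μ)
  · intro s j k hs hjk h _ ih
    rw [dPerm_permTableau, permElt_mul, mul_smul]
    exact swap_smul_mem_domSpan hjk (hs.row_lt hjk h) ih

theorem jmIdempotent_smul_of_ne {n : ℕ} {μ : Par n} {t u : Tableau μ} (ht : t.IsStandard)
    (hu : u.IsStandard) (h : u ≠ t) {v : HigherQuot μ} (hv : v ∈ wt (HigherQuot μ) (content u)) :
    jmIdempotent t • v = 0 :=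
  jmIdempotent_smul_eq_zero t hv (abs_content_lt u) fun e => h <| congrArg Subtype.val <|
    stdTableau_eq_of_content_eq (s := ⟨u, hu⟩) (t := ⟨t, ht⟩) e

theorem seminormal_mem_wt {n : ℕ} {μ : Par n} {t : Tableau μ} (ht : t.IsStandard) :
    seminormal t ∈ wt (HigherQuot μ) (content t) := by
  rw [seminormal_eq]
  refine smul_mem_of_mem_domSpan (fun u hu _ v hv => ?_) (dPerm_smul_mem_domSpan t ht)
  by_cases h : u = t
  · subst h
    rwa [jmIdempotent_smul_self _ hv]
  · rw [jmIdempotent_smul_of_ne ht hu h hv]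
    exact Submodule.zero_mem _

theorem seminormal_rowTableau {n : ℕ} (μ : Par n) :
    seminormal (rowTableau μ) = toQuot μ (rowSum μ) := by
  rw [seminormal_eq, dPerm_rowTableau, permElt_one, one_smul,
    jmIdempotent_smul_self _ (rowSum_mem_wt μ)]

/-- Moving down by an adjacent transposition. -/
theorem seminormal_permTableau {n : ℕ} {μ : Par n} {s : Tableau μ} (hs : s.IsStandard)
    {j k : Fin n} (hjk : (j : ℕ) + 1 = k) (h : 1 < content s j - content s k) :
    seminormal (permTableau (Equiv.swap j k) s) = permElt ℚ (Equiv.swap j k) • seminormal s +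
      (1 / ((content s j - content s k : ℤ) : ℚ)) • seminormal s := by
  have ht : (permTableau (Equiv.swap j k) s).IsStandard :=
    hs.permTableau hjk (by rw [ne_eq, abs_eq one_pos.le]; omega)
  have hrow : rowOf s j < rowOf s k := hs.row_lt hjk h
  have hnd : ¬ RowDom (rowOf (permTableau (Equiv.swap j k) s)) (rowOf s) := by
    rw [rowOf_permTableau]; exact not_rowDom_swap hjk hrow
  rw [seminormal_eq, seminormal_eq, dPerm_permTableau, permElt_mul, mul_smul]
  set σ := permElt ℚ (Equiv.swap j k) with hσ
  set t := permTableau (Equiv.swap j k) s with ht'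
  set H : ℚ := ((content s j - content s k : ℤ) : ℚ)
  -- The identity is checked on each weight `u` dominating `s`. Such `u` differs from `t`, which
  -- does not dominate `s`; and the intertwined vector of weight `(j, k) u` survives `E_t` only for
  -- `u = s`.
  have hA := eq_of_mem_domSpan (s := s) (A := actLin _ (jmIdempotent t) ∘ₗ actLin _ σ)
    (B := (actLin _ σ + (1 / H) • LinearMap.id) ∘ₗ actLin _ (jmIdempotent s)) ?_
    (dPerm_smul_mem_domSpan s hs)
  · simpa only [LinearMap.comp_apply, LinearMap.add_apply, LinearMap.smul_apply, actLin_apply,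
      LinearMap.id_apply] using hA
  intro u hu hus v hv
  simp only [LinearMap.comp_apply, LinearMap.add_apply, LinearMap.smul_apply, actLin_apply,
    LinearMap.id_apply]
  have hut : u ≠ t := by rintro rfl; exact hnd hus
  have hw := intertwine_mem_wt hv hjk (hu.content_sub_ne_zero hjk)
  have hv0 : jmIdempotent t • v = 0 := jmIdempotent_smul_of_ne ht hu hut hv
  have hE : jmIdempotent t • σ • v = jmIdempotent t •
      (σ • v + (1 / ((content u j - content u k : ℤ) : ℚ)) • v) := by
    rw [smul_add, grpAlg_smul_comm, hv0, smul_zero, add_zero]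
  rw [hE]
  by_cases h1 : u = s
  · subst h1
    rw [jmIdempotent_smul_self u hv]
    exact jmIdempotent_smul_self t hw
  · rw [jmIdempotent_smul_of_ne hs hu h1 hv, smul_zero, smul_zero, add_zero]
    refine jmIdempotent_smul_eq_zero t hw (fun i => abs_content_lt u _) fun e => h1 ?_
    refine congrArg Subtype.val <|
      stdTableau_eq_of_content_eq (s := ⟨u, hu⟩) (t := ⟨s, hs⟩) (funext fun i => ?_)
    have := congrFun e (Equiv.swap j k i)
    simpa [ht', content_permTableau] using this

/-- Moving up by an adjacent transposition. -/
theorem smul_seminormal_permTableau {n : ℕ} {μ : Par n} {s : Tableau μ} (hs : s.IsStandard)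
    {j k : Fin n} (hjk : (j : ℕ) + 1 = k) (h : content s j - content s k < -1) :
    ((((content s j - content s k : ℤ) : ℚ) ^ 2 - 1) / ((content s j - content s k : ℤ) : ℚ) ^ 2) •
      seminormal (permTableau (Equiv.swap j k) s) = permElt ℚ (Equiv.swap j k) • seminormal s +
      (1 / ((content s j - content s k : ℤ) : ℚ)) • seminormal s := by
  have ht : (permTableau (Equiv.swap j k) s).IsStandard :=
    hs.permTableau hjk (by rw [ne_eq, abs_eq one_pos.le]; omega)
  -- The upward formula is the downward one for the exchanged tableau, whose radial distance is
  -- `-h`, after applying the transposition once more.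
  have e := seminormal_permTableau ht hjk (by
    simp only [content_permTableau, Function.comp, Equiv.swap_apply_left,
      Equiv.swap_apply_right]; omega)
  rw [permTableau_permTableau] at e
  simp only [content_permTableau, Function.comp, Equiv.swap_apply_left,
      Equiv.swap_apply_right] at e
  have hneg : ((content s k - content s j : ℤ) : ℚ) = -((content s j - content s k : ℤ) : ℚ) := by
    push_cast; ring
  rw [hneg] at e
  have h0 : ((content s j - content s k : ℤ) : ℚ) ≠ 0 :=
    Int.cast_ne_zero.2 (hs.content_sub_ne_zero hjk)
  generalize ((content s j - content s k : ℤ) : ℚ) = H at *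
  rw [e, smul_add, swap_smul_smul, grpAlg_smul_comm]
  generalize seminormal (permTableau (Equiv.swap j k) s) = x
  generalize permElt ℚ (Equiv.swap j k) • x = y
  match_scalars
  · field_simp; ring
  · field_simp; ring

theorem smul_mem_span_of_forall {n : ℕ} {μ : Par n} {a : GrpAlg ℚ n} {S : Set (HigherQuot μ)}
    {N : Submodule ℚ (HigherQuot μ)} (h : ∀ v ∈ S, a • v ∈ N) {v : HigherQuot μ}
    (hv : v ∈ Submodule.span ℚ S) : a • v ∈ N :=
  Submodule.mem_comap.1 (Submodule.span_le (p := N.comap (actLin (HigherQuot μ) a)).2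
    (fun v hv => Submodule.mem_comap.2 (h v hv)) hv)

/-- The seminormal vectors span the rational Specht module. -/
theorem perm_smul_mem_span {n : ℕ} (μ : Par n) (g : Equiv.Perm (Fin n)) :
    permElt ℚ g • toQuot μ (rowSum μ) ∈
      Submodule.span ℚ (Set.range fun t : StdTableau μ => seminormal t.1) := by
  have hmem : ∀ t : Tableau μ, t.IsStandard → seminormal t ∈
      Submodule.span ℚ (Set.range fun t : StdTableau μ => seminormal t.1) :=
    fun t ht => Submodule.subset_span ⟨⟨t, ht⟩, rfl⟩
  induction g using permElt_induction with
  | h1 =>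
    rw [permElt_one, one_smul, ← seminormal_rowTableau]
    exact hmem _ (rowTableau_isStandard μ)
  | h j k hjk g ih =>
    rw [permElt_mul, mul_smul]
    refine smul_mem_span_of_forall (fun v hv => ?_) ih
    obtain ⟨⟨s, hs⟩, rfl⟩ := hv
    change permElt ℚ (Equiv.swap j k) • seminormal s ∈ _
    by_cases h1 : |content s j - content s k| = 1
    · rw [swap_smul_of_abs_eq_one (seminormal_mem_wt hs) hjk h1]
      exact Submodule.smul_mem _ _ (hmem s hs)
    · have ht := hs.permTableau hjk h1
      have h0 := hs.content_sub_ne_zero hjk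
      rw [abs_eq one_pos.le] at h1
      refine (Submodule.add_mem_iff_left _ (Submodule.smul_mem _
        (1 / ((content s j - content s k : ℤ) : ℚ)) (hmem s hs))).1 ?_
      rcases lt_or_gt_of_ne h0 with h | h
      · rw [← smul_seminormal_permTableau hs hjk (by omega)]
        exact Submodule.smul_mem _ _ (hmem _ ht)
      · rw [← seminormal_permTableau hs hjk (by omega)]
        exact hmem _ ht

/-! ### The vectors `φ^m ξ` -/

theorem sameResidues_swap_iff (p : ℕ) {n : ℕ} {μ : Par n} (s : Tableau μ) (j k : Fin n) :
    SameResidues p s (permTableau (Equiv.swap j k) s) ↔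
      ((content s j - content s k : ℤ) : ZMod p) = 0 := by
  rw [Int.cast_sub, sub_eq_zero]
  refine ⟨fun h => ?_, fun h i => ?_⟩
  · simpa [residue, content_permTableau] using h j
  · simp only [residue, content_permTableau, Function.comp, Equiv.swap_apply_def]
    split_ifs with h1 h2
    · rw [h1, h]
    · rw [h2, h]
    · rfl

open scoped Classical in
/-- `φ^m ξ_s` is obtained from `ξ_s` by the transposition plus a scalar. -/
theorem phiM_eq (p : ℕ) [Fact p.Prime] {n : ℕ} {μ : Par n} {s : Tableau μ} (hs : s.IsStandard)
    {j k : Fin n} (hjk : (j : ℕ) + 1 = k) :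
    phiM p j k s = permElt ℚ (Equiv.swap j k) • seminormal s +
      (if ((content s j - content s k : ℤ) : ZMod p) = 0 then (1 : ℚ)
        else 1 / ((content s j - content s k : ℤ) : ℚ)) • seminormal s := by
  have h0 := hs.content_sub_ne_zero hjk
  have hp : p ≠ 1 := (Fact.out : p.Prime).ne_one
  simp only [phiM, sameResidues_swap_iff]
  by_cases h1 : |content s j - content s k| = 1
  · have h2 : ((content s j - content s k : ℤ) : ZMod p) ≠ 0 := by
      rw [ne_eq, ZMod.intCast_zmod_eq_zero_iff_dvd, ← dvd_abs, h1, Int.natCast_dvd_ofNat]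
      simpa using hp
    rw [if_pos h1, if_neg h2, swap_smul_of_abs_eq_one (seminormal_mem_wt hs) hjk h1, neg_smul,
      neg_add_cancel]
  · rw [if_neg h1]
    rw [abs_eq one_pos.le] at h1
    have key : permElt ℚ (Equiv.swap j k) • seminormal s + (1 : ℚ) • seminormal s =
        (1 - 1 / ((content s j - content s k : ℤ) : ℚ)) • seminormal s +
        (permElt ℚ (Equiv.swap j k) • seminormal s +
          (1 / ((content s j - content s k : ℤ) : ℚ)) • seminormal s) := by
      rw [sub_smul]; abel
    rcases lt_or_gt_of_ne h0 with h | h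
    · have e := smul_seminormal_permTableau hs hjk (by omega : content s j - content s k < -1)
      have h3 : ¬ 1 < content s j - content s k := by omega
      have h4 : content s j - content s k < -1 := by omega
      by_cases hr : ((content s j - content s k : ℤ) : ZMod p) = 0
      · simp only [hr, h3, h4, not_true, and_false, false_and, if_false, and_self, if_true]
        rw [key, ← e]
      · simp only [hr, h3, h4, not_false_eq_true, false_and, if_false, and_self, if_true]
        rw [← e]
    · have e := seminormal_permTableau hs hjk (by omega : 1 < content s j - content s k)
      have h3 : 1 < content s j - content s k := by omega
      by_cases hr : ((content s j - content s k : ℤ) : ZMod p) = 0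
      · simp only [hr, h3, not_true, and_false, if_false, and_self, if_true]
        rw [key, ← e]
      · simp only [hr, h3, not_false_eq_true, if_false, and_self, if_true]
        rw [← e]

/-! ### The lattice `S(μ)` -/

theorem locRing_smul {p : ℕ} [Fact p.Prime] {n : ℕ} {μ : Par n} (r : LocRing p)
    (v : HigherQuot μ) : r • v = (r : ℚ) • v := rfl

theorem exists_locRing_eq_one_div {p : ℕ} [Fact p.Prime] {m : ℤ} (hm : (m : ZMod p) ≠ 0) :
    ∃ r : LocRing p, (r : ℚ) = 1 / (m : ℚ) := by
  refine ⟨⟨1 / (m : ℚ), fun h => hm ?_⟩, rfl⟩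
  rw [ZMod.intCast_zmod_eq_zero_iff_dvd]
  have := Rat.den_dvd 1 m
  rw [Rat.divInt_eq_div, Int.cast_one] at this
  exact (Int.natCast_dvd_natCast.2 h).trans this

theorem exists_pow_mul_mem_locRing (p : ℕ) [Fact p.Prime] (q : ℚ) :
    ∃ (e : ℕ) (r : LocRing p), (p : ℚ) ^ e * q = r := by
  obtain ⟨e, d, hd, hq⟩ := Nat.exists_eq_pow_mul_and_not_dvd q.den_ne_zero p
    (Fact.out : p.Prime).ne_one
  have hp : (p : ℚ) ≠ 0 := Nat.cast_ne_zero.2 (Fact.out : p.Prime).ne_zero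
  refine ⟨e, ⟨(q.num : ℚ) / ((d : ℤ) : ℚ), fun h => hd ?_⟩, ?_⟩
  · have h1 := Rat.den_dvd q.num d
    rw [Rat.divInt_eq_div] at h1
    exact Int.natCast_dvd_natCast.1 ((Int.natCast_dvd_natCast.2 h).trans h1)
  · change (p : ℚ) ^ e * q = (q.num : ℚ) / ((d : ℤ) : ℚ)
    have hd0 : (d : ℚ) ≠ 0 := Nat.cast_ne_zero.2 (fun h => hd (h ▸ dvd_zero p))
    conv_lhs => rw [← Rat.num_div_den q, hq]
    push_cast
    field_simp

/-- The elements of the rational group algebra that preserve the lattice `S(μ)`. -/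
def spechtStabilizer (p : ℕ) [Fact p.Prime] {n : ℕ} (μ : Par n) : Subring (GrpAlg ℚ n) where
  carrier := {a | ∀ v ∈ specht p μ, a • v ∈ specht p μ}
  one_mem' v hv := by rwa [one_smul]
  zero_mem' v hv := by rw [zero_smul]; exact Submodule.zero_mem _
  mul_mem' ha hb v hv := by rw [mul_smul]; exact ha _ (hb v hv)
  add_mem' ha hb v hv := by rw [add_smul]; exact Submodule.add_mem _ (ha v hv) (hb v hv)
  neg_mem' ha v hv := by rw [neg_smul]; exact Submodule.neg_mem _ (ha v hv)

theorem permElt_mem_spechtStabilizer (p : ℕ) [Fact p.Prime] {n : ℕ} (μ : Par n)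
    (g : Equiv.Perm (Fin n)) : permElt ℚ g ∈ spechtStabilizer p μ :=
  fun v hv => leftMul_mem p μ g v hv

theorem jucysMurphy_mem_spechtStabilizer (p : ℕ) [Fact p.Prime] {n : ℕ} (μ : Par n) (k : Fin n) :
    jucysMurphy ℚ k ∈ spechtStabilizer p μ :=
  Subring.sum_mem _ fun _ _ => permElt_mem_spechtStabilizer p μ _

theorem mem_span_seminormal {p : ℕ} [Fact p.Prime] {n : ℕ} {μ : Par n} {v : HigherQuot μ}
    (hv : v ∈ specht p μ) :
    ∃ a : StdTableau μ → ℚ, v = ∑ t, a t • seminormal t.1 := by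
  suffices v ∈ Submodule.span ℚ (Set.range fun t : StdTableau μ => seminormal t.1) by
    obtain ⟨a, ha⟩ := (Submodule.mem_span_range_iff_exists_fun ℚ).1 this
    exact ⟨a, ha.symm⟩
  induction hv using Submodule.span_induction with
  | mem v h =>
    obtain ⟨σ, s, rfl⟩ := h
    rw [murphyElt, dPerm_rowTableau, inv_one, permElt_one, mul_one, ← mul_assoc, ← permElt_mul,
      ← smul_toQuot]
    exact perm_smul_mem_span μ _
  | zero => exact Submodule.zero_mem _
  | add v w _ _ hv hw => exact Submodule.add_mem _ hv hw
  | smul r v _ hv => exact Submodule.smul_mem _ (r : ℚ) hv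

/-- The vectors with a multiple by a power of `p` in the lattice `S(μ)`. -/
def pPowerDivisible (p : ℕ) [Fact p.Prime] {n : ℕ} (μ : Par n) : Submodule ℚ (HigherQuot μ) where
  carrier := {v | ∃ M : ℕ, (p : ℚ) ^ M • v ∈ specht p μ}
  zero_mem' := ⟨0, by rw [smul_zero]; exact Submodule.zero_mem _⟩
  add_mem' := by
    rintro v w ⟨M, hM⟩ ⟨N, hN⟩
    refine ⟨M + N, ?_⟩
    have h1 := Submodule.smul_mem _ ((p : LocRing p) ^ N) hM
    have h2 := Submodule.smul_mem _ ((p : LocRing p) ^ M) hN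
    rw [locRing_smul, smul_smul] at h1 h2
    rw [smul_add, pow_add]
    refine Submodule.add_mem _ ?_ h2
    rw [mul_comm]
    exact h1
  smul_mem' := by
    rintro q v ⟨M, hM⟩
    obtain ⟨e, r, hr⟩ := exists_pow_mul_mem_locRing p q
    refine ⟨e + M, ?_⟩
    have h1 := Submodule.smul_mem _ r hM
    rw [locRing_smul, smul_smul, ← hr] at h1
    rw [smul_smul, pow_add]
    convert h1 using 2
    ring

theorem smul_mem_pPowerDivisible {p : ℕ} [Fact p.Prime] {n : ℕ} {μ : Par n} {v : HigherQuot μ}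
    (hv : v ∈ specht p μ) (a : GrpAlg ℚ n) : a • v ∈ pPowerDivisible p μ := by
  induction a using MonoidAlgebra.induction_on with
  | of g =>
    exact ⟨0, by rw [pow_zero, one_smul]; exact permElt_mem_spechtStabilizer p μ g v hv⟩
  | add a b ha hb => rw [add_smul]; exact Submodule.add_mem _ ha hb
  | smul r a ha => rw [smul_assoc]; exact Submodule.smul_mem _ r ha

theorem generator_mem_specht (p : ℕ) [Fact p.Prime] {n : ℕ} (μ : Par n) :
    toQuot μ (rowSum μ) ∈ specht p μ := by
  refine Submodule.subset_span ⟨1, ⟨_, rowTableau_isStandard μ⟩, ?_⟩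
  rw [murphyElt, dPerm_rowTableau, inv_one, permElt_one, one_mul, mul_one, one_mul]

theorem seminormal_mem_pPowerDivisible (p : ℕ) [Fact p.Prime] {n : ℕ} {μ : Par n}
    (t : Tableau μ) : seminormal t ∈ pPowerDivisible p μ := by
  rw [seminormal_eq, ← mul_smul]
  exact smul_mem_pPowerDivisible (generator_mem_specht p μ) _

theorem exists_pow_smul_sum_mem {p : ℕ} [Fact p.Prime] {n : ℕ} {μ : Par n} {ι : Type} [Fintype ι]
    (w : ι → HigherQuot μ) (hw : ∀ i, w i ∈ pPowerDivisible p μ) :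
    ∃ M : ℕ, ∀ c : ι → LocRing p, ∑ i, ((p : ℚ) ^ M * c i) • w i ∈ specht p μ := by
  choose m hm using hw
  refine ⟨∑ i, m i, fun c => Submodule.sum_mem _ fun i _ => ?_⟩
  have h := Submodule.smul_mem _ ((p : LocRing p) ^ (∑ i, m i - m i) * c i) (hm i)
  rw [locRing_smul, smul_smul] at h
  convert h using 2
  push_cast
  rw [mul_right_comm, ← pow_add, Nat.sub_add_cancel
    (Finset.single_le_sum (fun _ _ => Nat.zero_le _) (Finset.mem_univ i))]

/-! ### The class idempotents -/

theorem tableauClass_eq_iff {p n : ℕ} {μ : Par n} {t : StdTableau μ} {T : TableauClass p n} :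
    tableauClass p t = T ↔ ∀ k, residue p t.1 k = classResidue T k := by
  induction T using Quotient.inductionOn with
  | h s => exact Quotient.eq (r := residueSetoid p n)

open scoped Classical in
theorem classIdempotent_smul_seminormal {p n : ℕ} (T : TableauClass p n) {μ : Par n}
    (u : StdTableau μ) : classIdempotent T • seminormal u.1 =
      if tableauClass p u = T then seminormal u.1 else 0 := by
  have hu := seminormal_mem_wt u.2
  rw [classIdempotent, Finset.sum_smul, Finset.sum_eq_single ⟨μ, u⟩]
  · split_ifs
    · exact jmIdempotent_smul_self _ hu
    · exact zero_smul _ _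
  · intro t _ ht
    split_ifs
    · exact jmIdempotent_smul_eq_zero _ hu (abs_content_lt u.1) fun e =>
        ht (std_eq_of_content_eq (s := ⟨μ, u⟩) (t := t) e).symm
    · exact zero_smul _ _
  · exact fun h => absurd (Finset.mem_univ _) h

theorem pow_smul_of_smul_eq {n : ℕ} {μ : Par n} {a : GrpAlg ℚ n} {v : HigherQuot μ} {r : ℚ}
    (h : a • v = r • v) (m : ℕ) : a ^ m • v = r ^ m • v := by
  induction m with
  | zero => simp
  | succ m ih => rw [pow_succ, mul_smul, h, grpAlg_smul_comm, ih, smul_smul, ← pow_succ']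

theorem list_prod_map_smul {n : ℕ} {μ : Par n} {ι : Type} {a : ι → GrpAlg ℚ n}
    {v : HigherQuot μ} {r : ι → ℤ} (h : ∀ i, a i • v = (r i : ℚ) • v) (l : List ι) :
    (l.map a).prod • v = (((l.map r).prod : ℤ) : ℚ) • v := by
  induction l with
  | nil => simp
  | cons i l ih =>
    rw [List.map_cons, List.prod_cons, mul_smul, ih, grpAlg_smul_comm, h, smul_smul,
      List.map_cons, List.prod_cons, Int.cast_mul, mul_comm]

/-- An integral element acting on each seminormal vector by an integer that is congruent modulo
`p` to the scalar by which the class idempotent acts. -/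
theorem exists_approx_classIdempotent (p : ℕ) [Fact p.Prime] {n : ℕ} (T : TableauClass p n)
    (μ : Par n) : ∃ F ∈ spechtStabilizer p μ, ∃ f : StdTableau μ → ℤ,
      (∀ u, F • seminormal u.1 = (f u : ℚ) • seminormal u.1) ∧
      (∀ u, tableauClass p u = T → (f u : ZMod p) = 1) ∧
      (∀ u, tableauClass p u ≠ T → (f u : ZMod p) = 0) := by
  have hp1 : p - 1 ≠ 0 := by have := (Fact.out : p.Prime).two_le; omega
  let c : Fin n → ℤ := fun i => ((classResidue T i).val : ℤ)
  have hc : ∀ i, (c i : ZMod p) = classResidue T i := fun i => by simp [c]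
  -- By Fermat's little theorem `1 - (x - c_i)^(p - 1)` is 1 modulo `p` if `x ≡ c_i` and 0
  -- otherwise; the product over `i` detects the whole residue sequence.
  let a : Fin n → GrpAlg ℚ n := fun i => 1 - (jucysMurphy ℚ i - (c i : GrpAlg ℚ n)) ^ (p - 1)
  let r : StdTableau μ → Fin n → ℤ := fun u i => 1 - (content u.1 i - c i) ^ (p - 1)
  refine ⟨((List.finRange n).map a).prod, Subring.list_prod_mem _ fun x hx => ?_,
    fun u => ((List.finRange n).map (r u)).prod, fun u => list_prod_map_smul (fun i => ?_) _,
    fun u hu => ?_, fun u hu => ?_⟩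
  · obtain ⟨i, -, rfl⟩ := List.mem_map.1 hx
    exact sub_mem (one_mem _) (pow_mem (sub_mem (jucysMurphy_mem_spechtStabilizer p μ i)
      (intCast_mem _ _)) _)
  · have h1 : (jucysMurphy ℚ i - (c i : GrpAlg ℚ n)) • seminormal u.1 =
        ((content u.1 i - c i : ℤ) : ℚ) • seminormal u.1 := by
      rw [sub_smul, seminormal_mem_wt u.2 i, Int.cast_sub, sub_smul, Int.cast_smul_eq_zsmul,
        Int.cast_smul_eq_zsmul, Int.cast_smul_eq_zsmul]
    simp only [a, r]
    rw [sub_smul, pow_smul_of_smul_eq h1, one_smul]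
    push_cast
    rw [sub_smul, one_smul]
  · rw [tableauClass_eq_iff] at hu
    rw [Int.cast_list_prod, List.map_map]
    refine List.prod_eq_one fun x hx => ?_
    obtain ⟨i, -, rfl⟩ := List.mem_map.1 hx
    have h := hu i
    rw [residue] at h
    simp [r, hc, h, hp1]
  · rw [ne_eq, tableauClass_eq_iff, not_forall] at hu
    obtain ⟨i, hi⟩ := hu
    rw [Int.cast_list_prod, List.map_map]
    refine List.prod_eq_zero (List.mem_map.2 ⟨i, List.mem_finRange i, ?_⟩)
    rw [residue] at hi
    simp only [r, Function.comp, Int.cast_sub, Int.cast_one, Int.cast_pow, hc]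
    rw [ZMod.pow_card_sub_one_eq_one (sub_ne_zero.2 hi), sub_self]

open scoped Classical in
theorem classIdempotent_smul_sum {p n : ℕ} (T : TableauClass p n) {μ : Par n}
    (a : StdTableau μ → ℚ) : classIdempotent T • ∑ u, a u • seminormal u.1 =
      classSum T a seminormal := by
  rw [classSum, Finset.smul_sum]
  refine Finset.sum_congr rfl fun u _ => ?_
  rw [grpAlg_smul_comm, classIdempotent_smul_seminormal]
  split_ifs
  · rfl
  · exact smul_zero _

/-- Murphy's theorem: the class idempotent preserves the lattice. -/
theorem classIdempotent_smul_mem {p : ℕ} [Fact p.Prime] {n : ℕ} (T : TableauClass p n)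
    {μ : Par n} {v : HigherQuot μ} (hv : v ∈ specht p μ) :
    classIdempotent T • v ∈ specht p μ := by
  classical
  obtain ⟨a, rfl⟩ := mem_span_seminormal hv
  obtain ⟨F, hF, f, hf, hf1, hf0⟩ := exists_approx_classIdempotent p T μ
  obtain ⟨M, hM⟩ := exists_pow_smul_sum_mem (p := p) (fun u => a u • seminormal u.1)
    fun u => Submodule.smul_mem _ _ (seminormal_mem_pPowerDivisible p u.1)
  let δ : StdTableau μ → ℤ := fun u => if tableauClass p u = T then 1 else 0
  have hd : ∀ u, ∃ c : ℤ, δ u - f u ^ p ^ M = (p : ℤ) ^ M * c := by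
    intro u
    have h1 : ((p : ℕ) : ℤ) ∣ δ u - f u := by
      rw [← ZMod.intCast_zmod_eq_zero_iff_dvd, Int.cast_sub, sub_eq_zero]
      by_cases h : tableauClass p u = T
      · simp [δ, h, hf1 u h]
      · simp [δ, h, hf0 u h]
    -- A congruence modulo `p` becomes one modulo `p^(M+1)` after raising to the power `p^M`, and `δ
    -- u`, being 0 or 1, equals its own power.
    have h2 := (pow_dvd_pow (p : ℤ) (Nat.le_succ M)).trans (dvd_sub_pow_of_dvd_sub h1 M)
    have h3 : δ u ^ p ^ M = δ u := by
      simp only [δ]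
      split_ifs
      · rw [one_pow]
      · rw [zero_pow (pow_ne_zero _ (Fact.out : p.Prime).ne_zero)]
    rwa [h3] at h2
  choose c hc using hd
  have e : classIdempotent T • ∑ u, a u • seminormal u.1 =
      F ^ p ^ M • (∑ u, a u • seminormal u.1) +
        ∑ u, ((p : ℚ) ^ M * ((c u : LocRing p) : ℚ)) • a u • seminormal u.1 := by
    rw [classIdempotent_smul_sum, classSum, Finset.smul_sum, ← Finset.sum_add_distrib]
    refine Finset.sum_congr rfl fun u _ => ?_
    rw [grpAlg_smul_comm, pow_smul_of_smul_eq (hf u), smul_comm _ (a u), ← smul_add, ← add_smul]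
    have h : (f u : ℚ) ^ p ^ M + (p : ℚ) ^ M * ((c u : LocRing p) : ℚ) = (δ u : ℚ) := by
      have := congrArg (Int.cast : ℤ → ℚ) (hc u)
      push_cast at this ⊢
      linear_combination -this
    rw [h]
    simp only [δ]
    split_ifs <;> simp
  rw [e]
  exact Submodule.add_mem _ (pow_mem hF _ _ hv) (hM _)

/-! ### Reduction modulo `p` -/

theorem reduction_add {p : ℕ} [Fact p.Prime] {n : ℕ} {μ : Par n} (v w : specht p μ) :
    reduction (v + w) = reduction v + reduction w :=
  TensorProduct.tmul_add _ _ _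

theorem reduction_smul {p : ℕ} [Fact p.Prime] {n : ℕ} {μ : Par n} (r : LocRing p)
    (v : specht p μ) : reduction (r • v) = reduceRing p r • reduction v := by
  rw [reduction, reduction, ← TensorProduct.smul_tmul, TensorProduct.smul_tmul',
    Algebra.smul_def, smul_eq_mul]
  rfl

theorem reduction_sum {p : ℕ} [Fact p.Prime] {n : ℕ} {μ : Par n} {ι : Type} (s : Finset ι)
    (v : ι → specht p μ) : reduction (∑ i ∈ s, v i) = ∑ i ∈ s, reduction (v i) :=
  TensorProduct.tmul_sum _ _ _

theorem reduceRing_natCast_self (p : ℕ) [Fact p.Prime] : reduceRing p (p : LocRing p) = 0 := by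
  rw [map_natCast, ZMod.natCast_self]

theorem reduction_eq_zero_of_eq {p : ℕ} [Fact p.Prime] {n : ℕ} {μ : Par n} {v w : specht p μ}
    (h : v.1 = (p : ℚ) • w.1) : reduction v = 0 := by
  have e : v = (p : LocRing p) • w := Subtype.ext (by
    rw [h, Submodule.coe_smul, locRing_smul]; push_cast; rfl)
  rw [e, reduction_smul, reduceRing_natCast_self, zero_smul]

theorem actBar_reduction {p : ℕ} [Fact p.Prime] {n : ℕ} {μ : Par n} (a : GrpAlg (LocRing p) n)
    (v : specht p μ) :
    actBar p μ a (reduction v) = reduction ((spechtRep p μ).asAlgebraHom a v) :=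
  LinearMap.baseChange_tmul _ _ _

theorem asAlgebraHom_permElt {p : ℕ} [Fact p.Prime] {n : ℕ} {μ : Par n}
    (σ : Equiv.Perm (Fin n)) (v : specht p μ) :
    ((spechtRep p μ).asAlgebraHom (permElt (LocRing p) σ) v).1 = permElt ℚ σ • v.1 := by
  rw [permElt, Representation.asAlgebraHom_of]
  rfl

theorem asAlgebraHom_jucysMurphy {p : ℕ} [Fact p.Prime] {n : ℕ} {μ : Par n}
    (k : Fin n) (v : specht p μ) :
    ((spechtRep p μ).asAlgebraHom (jucysMurphy (LocRing p) k) v).1 = jucysMurphy ℚ k • v.1 := by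
  rw [jucysMurphy, jucysMurphy, map_sum, LinearMap.sum_apply, AddSubmonoidClass.coe_finsetSum,
    Finset.sum_smul]
  exact Finset.sum_congr rfl fun _ _ => asAlgebraHom_permElt _ _

/-- The operator `L_j - L_k - H` on the lattice. -/
def jmDiff (p : ℕ) [Fact p.Prime] {n : ℕ} (μ : Par n) (H : ℤ) (j k : Fin n) :
    Module.End (LocRing p) (specht p μ) :=
  (spechtRep p μ).asAlgebraHom (jucysMurphy (LocRing p) j - jucysMurphy (LocRing p) k) -
    (H : LocRing p) • LinearMap.id

theorem jmDiff_coe {p : ℕ} [Fact p.Prime] {n : ℕ} {μ : Par n} (H : ℤ) (j k : Fin n)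
    (v : specht p μ) : (jmDiff p μ H j k v).1 =
      (jucysMurphy ℚ j - jucysMurphy ℚ k) • v.1 - (H : ℚ) • v.1 := by
  rw [jmDiff, map_sub, LinearMap.sub_apply, LinearMap.sub_apply, AddSubgroupClass.coe_sub,
    AddSubgroupClass.coe_sub, asAlgebraHom_jucysMurphy, asAlgebraHom_jucysMurphy, sub_smul]
  rfl

theorem jmDiffNil_reduction {p : ℕ} [Fact p.Prime] {n : ℕ} {μ : Par n} {T : TableauClass p n}
    {j k : Fin n} {H : ℤ} (hH : (H : ZMod p) = classH T j k) (v : specht p μ) :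
    jmDiffNil T μ j k (reduction v) = reduction (jmDiff p μ H j k v) := by
  have h1 : jmDiff p μ H j k v = (spechtRep p μ).asAlgebraHom
      (jucysMurphy (LocRing p) j - jucysMurphy (LocRing p) k) v + (-(H : LocRing p)) • v := by
    rw [jmDiff, LinearMap.sub_apply, sub_eq_add_neg, LinearMap.smul_apply, LinearMap.id_apply]
    congr 1
    exact (neg_smul _ _).symm
  rw [h1, reduction_add, reduction_smul, ← actBar_reduction, jmDiffNil, LinearMap.sub_apply,
    map_neg, map_intCast, hH, Module.algebraMap_end_apply, sub_eq_add_neg]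
  congr 1
  exact (neg_smul _ _).symm

theorem jmDiffNil_pow_reduction {p : ℕ} [Fact p.Prime] {n : ℕ} {μ : Par n} {T : TableauClass p n}
    {j k : Fin n} {H : ℤ} (hH : (H : ZMod p) = classH T j k) (m : ℕ) (v : specht p μ) :
    (jmDiffNil T μ j k ^ m) (reduction v) = reduction ((jmDiff p μ H j k ^ m) v) := by
  induction m with
  | zero => rfl
  | succ m ih =>
    rw [pow_succ', pow_succ', Module.End.mul_apply, Module.End.mul_apply, ih,
      jmDiffNil_reduction hH]

/-- The operator `L_j - L_k - H` on a combination of weight vectors. -/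
theorem jmDiff_pow_coe {p : ℕ} [Fact p.Prime] {n : ℕ} {μ : Par n} (H : ℤ) (j k : Fin n)
    {ι : Type} [Fintype ι] (w : ι → HigherQuot μ) (g : ι → ℤ)
    (hw : ∀ i, (jucysMurphy ℚ j - jucysMurphy ℚ k) • w i = ((H + g i : ℤ) : ℚ) • w i)
    (v : specht p μ) (hv : v.1 = ∑ i, w i) (m : ℕ) :
    ((jmDiff p μ H j k ^ m) v).1 = ∑ i, ((g i : ℚ) ^ m) • w i := by
  induction m with
  | zero => simpa using hv
  | succ m ih =>
    rw [pow_succ', Module.End.mul_apply, jmDiff_coe, ih, Finset.smul_sum, Finset.smul_sum,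
      ← Finset.sum_sub_distrib]
    refine Finset.sum_congr rfl fun i _ => ?_
    rw [grpAlg_smul_comm, hw, smul_smul, smul_smul, ← sub_smul]
    congr 1
    push_cast; ring

theorem jmDiffInv_eq_sum {p : ℕ} [Fact p.Prime] {n : ℕ} {μ : Par n} {T : TableauClass p n}
    {j k : Fin n} {v : SpechtBar p μ} {N : ℕ} (hN : ∀ m ≥ N, (jmDiffNil T μ j k ^ m) v = 0) :
    jmDiffInv T μ j k v = (classH T j k)⁻¹ • ∑ m ∈ Finset.range N,
      (-1 : ZMod p) ^ m • (classH T j k)⁻¹ ^ m • (jmDiffNil T μ j k ^ m) v := by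
  rw [jmDiffInv]
  congr 1
  simp only [smul_pow, LinearMap.smul_apply]
  refine finsum_eq_sum_of_support_subset _ fun m hm => ?_
  rw [Finset.mem_coe, Finset.mem_range]
  by_contra h
  rw [Function.mem_support] at hm
  exact hm (by rw [hN m (not_lt.1 h), smul_zero, smul_zero])

/-- The truncated geometric series for `1 / (H + P)`. -/
theorem one_div_mul_geom_sum_add {H P : ℚ} (hH : H ≠ 0) (hP : H + P ≠ 0) (N : ℕ) :
    1 / H * ∑ m ∈ Finset.range N, (-(1 / H * P)) ^ m + 1 / (H + P) * (-(1 / H * P)) ^ N =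
      1 / (H + P) := by
  have h := geom_sum_mul (-(1 / H * P)) N
  generalize ∑ m ∈ Finset.range N, (-(1 / H * P)) ^ m = S at *
  generalize (-(1 / H * P)) ^ N = Q at *
  field_simp at h ⊢
  linear_combination -h

open scoped Classical in
/-- The intertwiner on a reduction, compared with the combination of the `φ^m ξ_t`. -/
theorem intertwiner_reduction {p : ℕ} [Fact p.Prime] {n : ℕ} {μ : Par n} {T : TableauClass p n}
    (x : specht p μ) (a : StdTableau μ → ℚ) (hx : x.1 = classSum T a seminormal) {j k : Fin n}
    (hjk : (j : ℕ) + 1 = k) :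
    (∃ N : ℕ, ∀ m ≥ N, (jmDiffNil T μ j k ^ m) (reduction x) = 0) ∧
      ∃ y : specht p μ, y.1 = classSum T a (phiM p j k) ∧
        intertwiner T μ j k (reduction x) = reduction y := by
  obtain ⟨H, hH⟩ := ZMod.intCast_surjective (classH T j k)
  let w : StdTableau μ → HigherQuot μ := fun t =>
    if tableauClass p t = T then a t • seminormal t.1 else 0
  -- Outside `T` the vector `w t` is zero, so the value `H` is harmless there and makes the
  -- congruence `hh t ≡ H` hold for every `t`.
  let hh : StdTableau μ → ℤ := fun t =>
    if tableauClass p t = T then content t.1 j - content t.1 k else H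
  have hhH : ∀ t, (hh t : ZMod p) = H := by
    intro t
    simp only [hh]
    split_ifs with ht
    · rw [hH, Int.cast_sub, classH, ← tableauClass_eq_iff.1 ht j, ← tableauClass_eq_iff.1 ht k]
      rfl
    · rfl
  have hxw : x.1 = ∑ t, w t := hx
  have hww : ∀ t, (jucysMurphy ℚ j - jucysMurphy ℚ k) • w t = (hh t : ℚ) • w t := by
    intro t
    simp only [w, hh]
    split_ifs with ht
    · rw [grpAlg_smul_comm, sub_smul, seminormal_mem_wt t.2 j, seminormal_mem_wt t.2 k, ← sub_smul,
        smul_comm, Int.cast_sub]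
    · rw [smul_zero, smul_zero]
  have hwp : ∀ t, w t ∈ pPowerDivisible p μ := by
    intro t
    simp only [w]
    split_ifs
    · exact Submodule.smul_mem _ _ (seminormal_mem_pPowerDivisible p t.1)
    · exact Submodule.zero_mem _
  have hg : ∀ t, ∃ g : ℤ, hh t = H + p * g := fun t => by
    have h := hhH t
    rw [← sub_eq_zero, ← Int.cast_sub, ZMod.intCast_zmod_eq_zero_iff_dvd] at h
    obtain ⟨g, hg⟩ := h
    exact ⟨g, by linarith⟩
  choose g hg using hg
  obtain ⟨M, hM⟩ := exists_pow_smul_sum_mem w hwp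
  -- The factor `p^M` brings the sum into the lattice and one further factor `p` makes it vanish
  -- modulo `p`.
  have hsmall : ∀ (m : ℕ), M + 1 ≤ m → ∀ c : StdTableau μ → LocRing p, ∃ s : specht p μ,
      ∑ t, ((p : ℚ) ^ m * c t) • w t = (p : ℚ) • s.1 := by
    intro m hm c
    obtain ⟨d, rfl⟩ := Nat.exists_eq_add_of_le hm
    refine ⟨⟨_, hM fun t => (p : LocRing p) ^ d * c t⟩, ?_⟩
    rw [Finset.smul_sum]
    refine Finset.sum_congr rfl fun t _ => ?_
    rw [smul_smul]
    congr 1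
    push_cast; ring
  have hpow := jmDiff_pow_coe (p := p) H j k w (fun t => p * g t)
    (fun t => by rw [hww, hg]) x hxw
  have hnil : ∀ m ≥ M + 1, (jmDiffNil T μ j k ^ m) (reduction x) = 0 := by
    intro m hm
    obtain ⟨s, hs⟩ := hsmall m hm fun t => (g t : LocRing p) ^ m
    rw [jmDiffNil_pow_reduction hH]
    refine reduction_eq_zero_of_eq (w := s) ?_
    rw [hpow, ← hs]
    refine Finset.sum_congr rfl fun t _ => ?_
    push_cast
    rw [mul_pow]
  refine ⟨⟨M + 1, hnil⟩, ?_⟩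
  have hphi : classSum T a (phiM p j k) = permElt ℚ (Equiv.swap j k) • x.1 +
      ∑ t, (if (H : ZMod p) = 0 then (1 : ℚ) else 1 / (hh t : ℚ)) • w t := by
    rw [hxw, Finset.smul_sum, classSum, ← Finset.sum_add_distrib]
    refine Finset.sum_congr rfl fun t _ => ?_
    have e := hhH t
    simp only [w, hh] at e ⊢
    split_ifs at e ⊢ with ht h1 h2
    · rw [phiM_eq p t.2 hjk, e, if_pos h1, smul_add, grpAlg_smul_comm, smul_comm (1 : ℚ)]
    · rw [phiM_eq p t.2 hjk, e, if_neg h1, smul_add, grpAlg_smul_comm, smul_comm _ (a t)]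
    all_goals simp
  let σx : specht p μ :=
    (spechtRep p μ).asAlgebraHom (permElt (LocRing p) (Equiv.swap j k)) x
  have hσx : σx.1 = permElt ℚ (Equiv.swap j k) • x.1 := asAlgebraHom_permElt _ _
  by_cases h0 : (H : ZMod p) = 0
  · refine ⟨σx + x, ?_, ?_⟩
    · rw [hphi, Submodule.coe_add, hσx]
      simp only [h0, if_true, one_smul]
      rw [hxw]
    · rw [intertwiner, if_pos (hH ▸ h0), actBar_reduction, reduction_add]
  · obtain ⟨r, hr⟩ := exists_locRing_eq_one_div h0
    have hrbar : reduceRing p r = (classH T j k)⁻¹ := by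
      have h1 : r * (H : LocRing p) = 1 := Subtype.ext (by
        push_cast
        rw [hr, one_div, inv_mul_cancel₀]
        exact Int.cast_ne_zero.2 fun h => h0 (by rw [h, Int.cast_zero]))
      have h2 := congrArg (reduceRing p) h1
      rw [map_mul, map_one, map_intCast, hH] at h2
      exact eq_inv_of_mul_eq_one_left h2
    -- The geometric series truncated at `M + 1` is applied in the lattice with `r = 1/H`; modulo
    -- `p` this is already the whole series.
    obtain ⟨z, hz1, hz⟩ : ∃ z : specht p μ, z.1 = ∑ t, ((r : ℚ) * ∑ m ∈ Finset.range (M + 1),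
        (-((r : ℚ) * (p * g t))) ^ m) • w t ∧ reduction z = jmDiffInv T μ j k (reduction x) := by
      refine ⟨r • ∑ m ∈ Finset.range (M + 1),
        (-1 : LocRing p) ^ m • r ^ m • (jmDiff p μ H j k ^ m) x, ?_, ?_⟩
      · simp only [Submodule.coe_smul, AddSubmonoidClass.coe_finsetSum, locRing_smul, hpow,
          Finset.smul_sum, Finset.mul_sum, Finset.sum_smul, smul_smul]
        rw [Finset.sum_comm]
        refine Finset.sum_congr rfl fun t _ => Finset.sum_congr rfl fun m _ => ?_
        congr 1
        push_cast
        rw [neg_pow, mul_pow]; ring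
      · rw [jmDiffInv_eq_sum hnil, reduction_smul, hrbar, reduction_sum]
        congr 1
        refine Finset.sum_congr rfl fun m _ => ?_
        rw [reduction_smul, reduction_smul, jmDiffNil_pow_reduction hH, map_pow, map_pow, hrbar,
          map_neg, map_one]
    have hr' : ∀ t, ∃ r' : LocRing p, (r' : ℚ) = 1 / (hh t : ℚ) := fun t =>
      exists_locRing_eq_one_div (by rw [hhH]; exact h0)
    choose r' hr' using hr'
    -- These coefficients, times `p^(M+1)`, are the remainders `(1/h)(-(h - H)/H)^(M+1)` of the
    -- truncated series for `1/h`, with `h = hh t`. Adding `p s` thus turns `z` into the exact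
    -- combination with coefficients `1/h` without changing its reduction.
    obtain ⟨s, hs⟩ := hsmall (M + 1) le_rfl fun t => r' t * (-(r * g t)) ^ (M + 1)
    refine ⟨σx + (z + (p : LocRing p) • s), ?_, ?_⟩
    · rw [hphi, Submodule.coe_add, hσx]
      congr 1
      have hps : ((p : LocRing p) • s).1 = (p : ℚ) • s.1 := by
        rw [Submodule.coe_smul, locRing_smul]; push_cast; rfl
      rw [Submodule.coe_add, hps, ← hs, hz1, ← Finset.sum_add_distrib]
      refine Finset.sum_congr rfl fun t _ => ?_
      rw [if_neg h0, ← add_smul]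
      congr 1
      have hH0 : (H : ℚ) ≠ 0 := Int.cast_ne_zero.2 fun h => h0 (by rw [h, Int.cast_zero])
      have ht0 : (hh t : ℚ) ≠ 0 := Int.cast_ne_zero.2 fun h => h0 (by
        rw [← hhH t, h, Int.cast_zero])
      have hht : (hh t : ℚ) = H + p * g t := by rw [hg t]; push_cast; ring
      rw [hht] at ht0
      have e := one_div_mul_geom_sum_add hH0 ht0 (M + 1)
      push_cast
      rw [hr', hr, hht, ← e]
      congr 1
      rw [mul_left_comm, ← mul_pow]
      congr 2; ring
    · rw [intertwiner, if_neg (hH ▸ h0), actBar_reduction, reduction_add, reduction_add,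
        reduction_smul, reduceRing_natCast_self, zero_smul, add_zero, hz]

end SeminormalForm

end

theorem mainTheorem4 (p : ℕ) [Fact p.Prime] (hp : 2 < p) (n : ℕ)
    (μ : SeminormalForm.Par n) (T : SeminormalForm.TableauClass p n)
    (x : SeminormalForm.HigherQuot μ) (hx : x ∈ SeminormalForm.classPart T μ) :
    ∃ hxS : x ∈ SeminormalForm.specht p μ,
      (∃ a : SeminormalForm.StdTableau μ → ℚ,
        x = SeminormalForm.classSum T a SeminormalForm.seminormal) ∧
      ∀ a : SeminormalForm.StdTableau μ → ℚ,
        x = SeminormalForm.classSum T a SeminormalForm.seminormal →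
        ∀ j k : Fin n, (j : ℕ) + 1 = (k : ℕ) →
          (∃ N : ℕ, ∀ m ≥ N,
            (SeminormalForm.jmDiffNil T μ j k ^ m) (SeminormalForm.reduction ⟨x, hxS⟩) = 0) ∧
          ∃ hy : SeminormalForm.classSum T a (SeminormalForm.phiM p j k) ∈
              SeminormalForm.specht p μ,
            SeminormalForm.intertwiner T μ j k (SeminormalForm.reduction ⟨x, hxS⟩) =
              SeminormalForm.reduction
                ⟨SeminormalForm.classSum T a (SeminormalForm.phiM p j k), hy⟩ := by
  obtain ⟨v, hv, rfl⟩ := hx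
  refine ⟨SeminormalForm.classIdempotent_smul_mem T hv, ?_, fun a ha j k hjk => ?_⟩
  · obtain ⟨a, rfl⟩ := SeminormalForm.mem_span_seminormal hv
    exact ⟨a, SeminormalForm.classIdempotent_smul_sum T a⟩
  · obtain ⟨hN, ⟨y, hyS⟩, rfl, h⟩ := SeminormalForm.intertwiner_reduction
      ⟨_, SeminormalForm.classIdempotent_smul_mem T hv⟩ a ha hjk
    exact ⟨hN, hyS, h⟩
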